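/- **Model.** Time is divided into epochs $0,1,2,\dots$. Let $m>0$ and $0\le\beta\le 1$. In each epoch $r$, $H[r]$ honest and $Z[r]$ adversarial leaders are elected; all these numbers are independent, $H[r]$ is Poisson with mean $(1-\beta)m$ and $Z[r]$ is Poisson with mean $\beta m$. Each elected leader gets an election proof for that epoch. A block carries an epoch, an election proof, a set of parent blocks and a list of transactions. A *tipset* is a non-empty set of blocks with the same epoch, the same parents and pairwise distinct election proofs. A block other than the genesis block (which has epoch $0$ and no parents) is *valid* if its proof was won in its epoch and its parents form a tipset of valid blocks of a smaller epoch. A *chain* is a sequence of tipsets of valid blocks that starts with $\{\text{genesis}\}$ and in which each tipset is the parent set of the blocks of the next one; its *weight* is its number of blocks. Honest nodes run Expected Consensus in the lock-step synchronous model. At the end of each epoch, every honest node adopts a heaviest chain among the chains of valid blocks it has received (none of which has an epoch still to come). For each honest leader of an epoch $r\ge 1$, the honest node holding that election proof makes one block of epoch $r$; its parent set is the last tipset of the chain this node adopted at the end of epoch $r-1$, and it contains all transactions which the node received by the end of epoch $r-1$ and which are not yet in that chain. This block reaches all honest nodes by the end of epoch $r$. Every block known to one honest node at the end of an epoch is known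 to all honest nodes at the end of the next one. The adversary cannot make blocks with honest proofs. Everything else is up to the adversary, which may even know all elections in advance: which honest node holds each honest proof, the number, the content and the delivery of the blocks made with adversarial proofs (several different blocks may carry the same proof), all ties between heaviest chains (separately for each node and epoch), and the arrival of transactions. A *ledger rule* maps each chain to a list of transactions that contains exactly the transactions of the blocks of the chain, such that the list of a prefix of a chain is a prefix of the list of the chain. The *ledger* of a node at epoch $i$ is the list of the chain it adopts at the end of epoch $i$, and the *position* of a transaction in it is that of its first occurrence. A transaction is *$\tau$-confirmed* for a node at epoch $i$ if it lies in a block of epoch $j\le i-\tau$ of the node's chain. * *Persistence at epoch $i$ with parameter $\tau$:* every transaction that is $\tau$-confirmed at epoch $i$ for one honest node is, at every epoch $k\ge i$ and for every honest node, $\tau$-confirmed and in the same position in the ledger. * *Liveness at epoch $i$ with parameter $u$:* for every transaction received by all honest nodes by the end of epoch $i$ there is a position that it has in the ledgers of all honest nodes at all epochs $k\ge i+u$. **Theorem.** Suppose $\beta m<1-e^{-(1-\beta)m}$ and let $0<\varepsilon<1$. There are constants $c>0$ and $\kappa_0$, depending only on $m,\beta,\varepsilon$, such that for every real $\kappa\ge\kappa_0$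 and every epoch $i$, with probability at least $1-e^{-c\kappa^{1-\varepsilon}}$ over the elections, the following holds whatever the adversary does and for every ledger rule: the ledger generated by Expected Consensus has persistence at epoch $i$ with parameter $\tau=\kappa$ and liveness at epoch $i$ with parameter $u=\kappa$. -/

import Mathlib

namespace ExpectedConsensus

/-- An election proof: the `index`-th honest, respectively adversarial, leader of an epoch. -/
inductive Ticket where
  | honest (epoch index : ℕ) : Ticket
  | adversarial (epoch index : ℕ) : Ticket

/-- The epoch in which an election proof was won. -/
def Ticket.epoch : Ticket → ℕ
  | .honest r _ => r
  | .adversarial r _ => r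

/-- An election proof is genuine when its index is below the number of leaders elected on its side
in its epoch; `h r` and `z r` count the honest and the adversarial leaders of epoch `r`. -/
def Ticket.Wins (h z : ℕ → ℕ) : Ticket → Prop
  | .honest r k => k < h r
  | .adversarial r k => k < z r

/-- A universe of blocks. Each block carries an epoch number, an election proof, the set of its
parent blocks and a list of transactions. The label `ticket` of the genesis block has no meaning.
Several blocks may carry the same election proof (equivocation). -/
structure BlockDAG (Block Tx : Type*) where
  genesis : Block
  epoch : Block → ℕ
  ticket : Block → Ticket
  parents : Block → Finset Block
  payload : Block → List Tx
  genesis_epoch : epoch genesis = 0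
  genesis_parents : parents genesis = ∅

namespace BlockDAG

variable {Block Tx : Type*} (D : BlockDAG Block Tx)

/-- A tipset: a non-empty set of blocks of one epoch with the same set of parents, in which
no election proof is used twice (so that one election adds at most one block to a chain). -/
def IsTipset (T : Finset Block) : Prop :=
  T.Nonempty ∧
    (∀ B ∈ T, ∀ B' ∈ T, D.epoch B = D.epoch B' ∧ D.parents B = D.parents B') ∧
    Set.InjOn D.ticket (T : Set Block)

/-- Block validity: the genesis block is valid; another block is valid when its election proof is
genuine and of its own epoch, and its parents form a tipset of valid blocks of a smaller epoch. -/
inductive Valid (h z : ℕ → ℕ) : Block → Prop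
  | genesis : Valid h z D.genesis
  | block (B : Block) (ticket_epoch : (D.ticket B).epoch = D.epoch B)
      (ticket_wins : (D.ticket B).Wins h z) (parents_tipset : D.IsTipset (D.parents B))
      (parents_epoch : ∀ P ∈ D.parents B, D.epoch P < D.epoch B)
      (parents_valid : ∀ P ∈ D.parents B, Valid h z P) : Valid h z B

/-- A (valid) chain: a list of tipsets of valid blocks, oldest first, that starts with the genesis
tipset and in which each tipset is the set of parents of the next one. -/
def IsChain (h z : ℕ → ℕ) (C : List (Finset Block)) : Prop :=
  C.head? = some {D.genesis} ∧
    (∀ T ∈ C, D.IsTipset T ∧ ∀ B ∈ T, D.Valid h z B) ∧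
    List.IsChain (fun S T => ∀ B ∈ T, D.parents B = S) C

/-- The weight of a chain: the number of its blocks. -/
def weight (C : List (Finset Block)) : ℕ := (C.map Finset.card).sum

/-- Block `B` occurs in the chain `C`. -/
def InChain (B : Block) (C : List (Finset Block)) : Prop := ∃ T ∈ C, B ∈ T

/-- The transaction `tx` is contained in some block of the chain `C`. -/
def TxInChain (tx : Tx) (C : List (Finset Block)) : Prop :=
  ∃ B, InChain B C ∧ tx ∈ D.payload B

/-- The fork choice rule: `C` is a heaviest chain among all chains that consist of blocks of `V`.
It leaves ties open. -/
def IsHeaviest (h z : ℕ → ℕ) (V : Set Block) (C : List (Finset Block)) : Prop :=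
  (D.IsChain h z C ∧ ∀ B, InChain B C → B ∈ V) ∧
    ∀ C', D.IsChain h z C' → (∀ B, InChain B C' → B ∈ V) → weight C' ≤ weight C

/-- A rule that generates a transaction ledger from a chain: the ledger lists exactly the
transactions of the chain, and the ledger of a prefix of a chain is a prefix of its ledger. -/
structure IsLedgerRule (h z : ℕ → ℕ) (L : List (Finset Block) → List Tx) : Prop where
  mem_iff : ∀ C, D.IsChain h z C → ∀ tx, tx ∈ L C ↔ D.TxInChain tx C
  append_only : ∀ C C', D.IsChain h z C → D.IsChain h z C' → C <+: C' → L C <+: L C'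

end BlockDAG

/-- What happens in a run of the protocol, as far as honest nodes are concerned. -/
structure Execution (Node Block Tx : Type*) extends BlockDAG Block Tx where
  /-- The honest node that holds the `k`-th honest election proof of epoch `r`. -/
  owner : ℕ → ℕ → Node
  /-- The block made with the `k`-th honest election proof of epoch `r`. -/
  mined : ℕ → ℕ → Block
  /-- The transactions that a node has received by the end of epoch `r`. -/
  received : Node → ℕ → Finset Tx
  /-- The blocks that a node has received and accepted by the end of epoch `r`. -/
  view : Node → ℕ → Set Block
  /-- The chain that a node adopts at the end of epoch `r`. -/
  chain : Node → ℕ → List (Finset Block)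

namespace Execution

variable {Node Block Tx : Type*} (E : Execution Node Block Tx)

/-- The runs that are possible in the lock-step synchronous model when `h r` honest and `z r`
adversarial leaders are elected in epoch `r`. Everything that the rules below leave open is
decided by the adversary: which honest nodes win, the blocks made with adversarial election
proofs (any number for each proof, at any time from its epoch on), which of them reach which
honest node and when, how ties between heaviest chains are broken for each node in each epoch,
and which transactions arrive where. -/
structure Admissible (h z : ℕ → ℕ) : Prop where
  /-- Every node knows the genesis block. -/
  genesis_mem : ∀ n r, E.genesis ∈ E.view n r
  /-- Nodes accept valid blocks only, and no block exists before its epoch. -/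
  view_valid : ∀ n r, ∀ B ∈ E.view n r, E.Valid h z B ∧ E.epoch B ≤ r
  /-- A block known to one honest node reaches all honest nodes by the end of the next epoch. -/
  rebroadcast : ∀ n n' r, E.view n r ⊆ E.view n' (r + 1)
  /-- The adversary cannot make blocks with honest election proofs. -/
  no_forgery : ∀ n r, ∀ B ∈ E.view n r, B ≠ E.genesis →
    ∀ e k, E.ticket B = Ticket.honest e k → B = E.mined e k
  /-- Honest nodes follow the fork choice rule. -/
  fork_choice : ∀ n r, E.IsHeaviest h z (E.view n r) (E.chain n r)
  /-- Received transactions are kept. -/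
  received_mono : ∀ n, Monotone (E.received n)
  /-- An honest leader makes one block with its proof in the epoch of the proof. -/
  mined_label : ∀ r k, k < h (r + 1) →
    E.epoch (E.mined (r + 1) k) = r + 1 ∧ E.ticket (E.mined (r + 1) k) = Ticket.honest (r + 1) k
  /-- The parents of an honest block are the tip of the chain that its maker has adopted. -/
  mined_parents : ∀ r k, k < h (r + 1) →
    (E.chain (E.owner (r + 1) k) r).getLast? = some (E.parents (E.mined (r + 1) k))
  /-- An honest block contains all transactions known to its maker that are not yet in the chain
  which it extends. -/
  mined_payload : ∀ r k, k < h (r + 1) → ∀ tx ∈ E.received (E.owner (r + 1) k) r,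
    ¬ E.TxInChain tx (E.chain (E.owner (r + 1) k) r) → tx ∈ E.payload (E.mined (r + 1) k)
  /-- An honest block reaches all honest nodes by the end of its epoch. -/
  mined_delivered : ∀ r k, k < h (r + 1) → ∀ n, E.mined (r + 1) k ∈ E.view n (r + 1)

/-- The position of `tx` in the list `l` (its first occurrence) is `p`. -/
def IsAt {α : Type*} (l : List α) (tx : α) (p : ℕ) : Prop :=
  l[p]? = some tx ∧ tx ∉ l.take p

/-- In the view of node `n`, at the end of epoch `i`, the transaction `tx` has position `p` in the
ledger and is `τ`-confirmed: it appears in a block of epoch at most `i - τ` of the node's chain. -/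
def Confirmed (L : List (Finset Block) → List Tx) (τ : ℝ) (i : ℕ) (n : Node) (tx : Tx) (p : ℕ) :
    Prop :=
  IsAt (L (E.chain n i)) tx p ∧
    ∃ B, BlockDAG.InChain B (E.chain n i) ∧ tx ∈ E.payload B ∧ (E.epoch B : ℝ) ≤ (i : ℝ) - τ

/-- Persistence at epoch `i`: a transaction that is `τ`-confirmed for one honest node at epoch `i`
is `τ`-confirmed in the same position for all honest nodes at every epoch `k ≥ i`. -/
def Persistence (L : List (Finset Block) → List Tx) (τ : ℝ) (i : ℕ) : Prop :=
  ∀ n tx p, E.Confirmed L τ i n tx p → ∀ k, i ≤ k → ∀ n', E.Confirmed L τ k n' tx p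

/-- Liveness at epoch `i`: a transaction that all honest nodes have received at epoch `i` has, from
epoch `i + u` on, forever the same position in the ledgers of all honest nodes. -/
def Liveness (L : List (Finset Block) → List Tx) (u : ℝ) (i : ℕ) : Prop :=
  ∀ tx, (∀ n, tx ∈ E.received n i) →
    ∃ p, ∀ k : ℕ, (i : ℝ) + u ≤ (k : ℝ) → ∀ n, IsAt (L (E.chain n k)) tx p

end Execution

open MeasureTheory ProbabilityTheory in
/-- The leader election: the numbers `H r` of honest and `Z r` of adversarial leaders of the epochs
`r` are all independent and have Poisson laws with means `(1 - β) m` and `β m`. -/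
structure LeaderElection {Ω : Type*} [MeasurableSpace Ω] (μ : Measure Ω) (m β : ℝ)
    (H Z : ℕ → Ω → ℕ) : Prop where
  law_honest : ∀ r, HasLaw (H r) (poissonMeasure ((1 - β) * m).toNNReal) μ
  law_adversarial : ∀ r, HasLaw (Z r) (poissonMeasure (β * m).toNNReal) μ
  indep : iIndepFun (Sum.elim H Z) μ

end ExpectedConsensus

/-! The proof splits into a deterministic statement about cut epochs (`IsCut`) and an estimate
showing that long windows without a cut are exponentially rare.

Deterministic part. Adopted weight grows by at least one in every epoch with an honest leader,
whereas a stretch of a chain without honest blocks uses each adversarial election at most once. Take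
a chain adopted at epoch `r` and its last tipset containing an honest block, of epoch `s`. The chain
below that tipset, together with its honest blocks, is known to all honest nodes at the end of epoch
`s`. Hence the adversarial leaders of `[s, r]` must make up for the honest growth over `(s, r]`
(`weight_bound`). A cut `j ≤ r` with `s < j` forbids this. By induction every chain adopted from `j`
on contains the unique block of epoch `j` (`exists_append_cons_mined`), and therefore the whole
chain below it. A cut in `(i - κ, i]` gives persistence and one in `(i, i + κ]` gives liveness,
whatever the adversary does.

Probabilistic part. The increments `min (H t) 1 - Z t` are independent with positive mean, and a cut
is a point where their walk reaches a new maximum and does not fall back. This event involves the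
whole past and future, so it is split by a range `K`. Local cuts, which look only `K` steps each
way, have probability bounded below uniformly in `K` and are independent at centres `2K + 1` apart.
A violation farther away forces a reflected, exponentially tilted walk (`maxProd`) above a level
exponential in `K`. An exponential moment bounds the time above that level
(`measure_card_le_maxProd_le`), with a rate that is exponentially small in `K`, whereas local cuts
have density of order `1 / K`. For one large fixed `K` the local cuts outnumber both kinds of
violation, up to exponentially small probability (`measure_no_cut_le`). The resulting bound is
exponential in `κ`, stronger than the stated one. -/

namespace ExpectedConsensus

/-! ### Chains, tipsets and adversarial weight -/

namespace BlockDAG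

variable {Block Tx : Type*} {D : BlockDAG Block Tx} {h z : ℕ → ℕ}

/-- A block that no adversary can fabricate: genesis, or one made with an honest proof. -/
def Honest (D : BlockDAG Block Tx) (B : Block) : Prop :=
  B = D.genesis ∨ ∃ e k, D.ticket B = Ticket.honest e k

theorem Valid.of_ne_genesis {B : Block} (hB : D.Valid h z B) (hne : B ≠ D.genesis) :
    (D.ticket B).epoch = D.epoch B ∧ (D.ticket B).Wins h z ∧
      D.IsTipset (D.parents B) ∧ ∀ P ∈ D.parents B, D.epoch P < D.epoch B := by
  cases hB with
  | genesis => exact absurd rfl hne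
  | block _ h1 h2 h3 h4 h5 => exact ⟨h1, h2, h3, h4⟩

theorem IsChain.of_append {P Q : List (Finset Block)} (hC : D.IsChain h z (P ++ Q))
    (hP : P ≠ []) : D.IsChain h z P := by
  obtain ⟨h1, h2, h3⟩ := hC
  refine ⟨?_, fun T hT => h2 T (List.mem_append_left _ hT), (List.isChain_append.1 h3).1⟩
  cases P with
  | nil => exact absurd rfl hP
  | cons a P => simpa using h1

theorem IsChain.concat {C : List (Finset Block)} {S T : Finset Block} (hC : D.IsChain h z C)
    (hS : C.getLast? = some S) (hT : D.IsTipset T) (hV : ∀ B ∈ T, D.Valid h z B)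
    (hp : ∀ B ∈ T, D.parents B = S) : D.IsChain h z (C ++ [T]) := by
  obtain ⟨h1, h2, h3⟩ := hC
  refine ⟨?_, ?_, ?_⟩
  · cases C with
    | nil => simp at h1
    | cons a P => simpa using h1
  · intro T' hT'
    rcases List.mem_append.1 hT' with h' | h'
    · exact h2 T' h'
    · rw [List.mem_singleton.1 h']
      exact ⟨hT, hV⟩
  · refine List.isChain_append.2 ⟨h3, by simp, ?_⟩
    intro x hx y hy
    rw [hS] at hx
    simp at hx hy
    subst hx hy
    exact hp

theorem IsChain.getLast?_eq_parents {P Q : List (Finset Block)} {T : Finset Block} {B : Block}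
    (hC : D.IsChain h z (P ++ T :: Q)) (hP : P ≠ []) (hB : B ∈ T) :
    P.getLast? = some (D.parents B) := by
  have h3 := (List.isChain_append.1 hC.2.2).2.2 (P.getLast hP)
    (by simp [List.getLast?_eq_some_getLast hP]) T (by simp) B hB
  rw [List.getLast?_eq_some_getLast hP, h3]

theorem IsChain.ne_genesis {P Q : List (Finset Block)} {T : Finset Block} {B : Block}
    (hC : D.IsChain h z (P ++ T :: Q)) (hP : P ≠ []) (hB : B ∈ T) : B ≠ D.genesis := by
  rintro rfl
  have h1 := hC.getLast?_eq_parents hP hB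
  rw [D.genesis_parents] at h1
  have h2 := (hC.2.1 ∅ (List.mem_append_left _ (List.mem_of_getLast? h1))).1.1
  simp at h2

theorem IsChain.head_eq {Q : List (Finset Block)} {T : Finset Block}
    (hC : D.IsChain h z (T :: Q)) : T = {D.genesis} := by
  simpa using hC.1

/-- A chain is determined by its last tipset. -/
theorem IsChain.eq_of_getLast? {C C' : List (Finset Block)} (hC : D.IsChain h z C)
    (hC' : D.IsChain h z C') (hl : C.getLast? = C'.getLast?) : C = C' := by
  induction C using List.reverseRecOn generalizing C' with
  | nil => simpa using hC.1
  | append_singleton P T ih =>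
    rcases List.eq_nil_or_concat C' with rfl | ⟨P', T', rfl⟩
    · simpa using hC'.1
    simp only [List.concat_eq_append] at hC' hl ⊢
    have hT : T = T' := by simpa using hl
    subst hT
    obtain ⟨B, hB⟩ := (hC.2.1 T (by simp)).1.1
    -- Genesis has no parents, so it occurs only in the head tipset; chains of which just one has a
    -- single tipset therefore cannot share their tip.
    by_cases hP : P = []
    · subst hP
      have hT := IsChain.head_eq hC
      subst hT
      by_cases hP' : P' = []
      · rw [hP']
      · exact absurd rfl (hC'.ne_genesis hP' (Finset.mem_singleton_self _))
    · by_cases hP' : P' = []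
      · subst hP'
        have hT := IsChain.head_eq hC'
        subst hT
        exact absurd rfl (hC.ne_genesis hP (Finset.mem_singleton_self _))
      · rw [ih (hC.of_append hP) (hC'.of_append hP')]
        rw [hC.getLast?_eq_parents hP hB, hC'.getLast?_eq_parents hP' hB]

/-- A tipset contains at most one adversarial block per adversarial election. -/
theorem card_filter_not_honest_le [DecidablePred D.Honest] {T : Finset Block} {s : ℕ}
    (hT : D.IsTipset T) (hV : ∀ B ∈ T, D.Valid h z B) (hs : ∀ B ∈ T, D.epoch B = s) :
    (T.filter fun B => ¬ D.Honest B).card ≤ z s := by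
  classical
  have key : ∀ B ∈ T.filter fun B => ¬ D.Honest B,
      ∃ k, k < z s ∧ D.ticket B = Ticket.adversarial s k := by
    intro B hB
    rw [Finset.mem_filter] at hB
    obtain ⟨h1, h2, -⟩ := (hV B hB.1).of_ne_genesis fun he => hB.2 (Or.inl he)
    cases ht : D.ticket B with
    | honest e k => exact absurd (Or.inr ⟨e, k, ht⟩) hB.2
    | adversarial e k =>
      rw [ht] at h1 h2
      simp only [Ticket.epoch, Ticket.Wins] at h1 h2
      rw [hs B hB.1] at h1
      subst h1
      exact ⟨k, h2, rfl⟩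
  choose! k hk using key
  rw [← Finset.card_range (z s)]
  refine Finset.card_le_card_of_injOn k (fun B hB => Finset.mem_coe.2 (Finset.mem_range.2 (hk B hB).1)) ?_
  intro B hB B' hB' he
  refine hT.2.2 (Finset.mem_filter.1 hB).1 (Finset.mem_filter.1 hB').1 ?_
  rw [(hk B hB).2, (hk B' hB').2, he]

theorem epoch_lt_of_parents {S T : Finset Block} (hS : S.Nonempty) (hp : ∀ B ∈ T, D.parents B = S)
    (hV : ∀ B ∈ T, D.Valid h z B) {B B' : Block} (hB : B ∈ T) (hB' : B' ∈ S) :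
    D.epoch B' < D.epoch B := by
  have hne : B ≠ D.genesis := by
    rintro rfl
    have := hp _ hB
    rw [D.genesis_parents] at this
    simp [← this] at hS
  exact ((hV B hB).of_ne_genesis hne).2.2.2 B' (by rwa [hp B hB])

/-- The weight of a purely adversarial extension is bounded by the adversarial elections. -/
theorem weight_le_sum_of_not_honest {r : ℕ} (Q : List (Finset Block)) (T : Finset Block) (s : ℕ)
    (hT : ∀ S ∈ T :: Q, D.IsTipset S ∧ ∀ B ∈ S, D.Valid h z B)
    (hc : List.IsChain (fun S T => ∀ B ∈ T, D.parents B = S) (T :: Q))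
    (hs : ∀ B ∈ T, D.epoch B = s) (hQ : ∀ S ∈ Q, ∀ B ∈ S, ¬ D.Honest B ∧ D.epoch B ≤ r) :
    weight Q ≤ ∑ t ∈ Finset.Ioc s r, z t := by
  classical
  induction Q generalizing T s with
  | nil => simp [weight]
  | cons T' Q ih =>
    rw [List.isChain_cons_cons] at hc
    have hT' := hT T' (by simp)
    obtain ⟨B, hB⟩ := hT'.1.1
    obtain ⟨A, hA⟩ := (hT T (by simp)).1.1
    have h1 := ih T' (D.epoch B) (fun S hS => hT S (List.mem_cons_of_mem _ hS)) hc.2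
      (fun B' hB' => (hT'.1.2.1 B' hB' B hB).1) (fun S hS => hQ S (List.mem_cons_of_mem _ hS))
    have hlt : s < D.epoch B := by
      rw [← hs A hA]
      exact epoch_lt_of_parents (hT T (by simp)).1.1 hc.1 hT'.2 hB hA
    have hle : D.epoch B ≤ r := (hQ T' (by simp) B hB).2
    have h2 : T'.card ≤ z (D.epoch B) := by
      have := card_filter_not_honest_le hT'.1 hT'.2 (fun B' hB' => (hT'.1.2.1 B' hB' B hB).1)
      rwa [Finset.filter_true_of_mem fun B' hB' => (hQ T' (by simp) B' hB').1] at this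
    -- Epochs strictly increase along a chain, so each epoch is charged at most once.
    have h3 : ∑ t ∈ insert (D.epoch B) (Finset.Ioc (D.epoch B) r), z t ≤
        ∑ t ∈ Finset.Ioc s r, z t := by
      refine Finset.sum_le_sum_of_subset fun t ht => ?_
      simp only [Finset.mem_insert, Finset.mem_Ioc] at ht ⊢
      omega
    rw [Finset.sum_insert (by simp)] at h3
    simp only [weight, List.map_cons, List.sum_cons] at h1 ⊢
    omega

theorem weight_append (P Q : List (Finset Block)) : weight (P ++ Q) = weight P + weight Q := by
  simp [weight]

theorem weight_cons (T : Finset Block) (Q : List (Finset Block)) :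
    weight (T :: Q) = T.card + weight Q := by
  simp [weight]

theorem inChain_append {B : Block} {P Q : List (Finset Block)} :
    InChain B (P ++ Q) ↔ InChain B P ∨ InChain B Q := by
  simp [InChain, or_and_right, exists_or]

end BlockDAG

/-- Splitting at the last element with `p`; it serves to find the last tipset of a chain that holds
an honest block. -/
theorem _root_.List.exists_append_cons_forall_not {α : Type*} {p : α → Prop} {l : List α}
    (hl : ∃ a ∈ l, p a) : ∃ P a Q, l = P ++ a :: Q ∧ p a ∧ ∀ b ∈ Q, ¬ p b := by
  induction l with
  | nil => simp at hl
  | cons a l ih =>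
    by_cases h : ∃ b ∈ l, p b
    · obtain ⟨P, b, Q, rfl, hb, hQ⟩ := ih h
      exact ⟨a :: P, b, Q, rfl, hb, hQ⟩
    · push Not at h
      refine ⟨[], a, l, rfl, ?_, h⟩
      obtain ⟨b, hb, hpb⟩ := hl
      rcases List.mem_cons.1 hb with rfl | hb
      · exact hpb
      · exact absurd hpb (h b hb)

/-! ### Cut epochs and the common prefix they force -/

/-- An epoch whose only elected leader is honest, such that over every interval around it the
number of epochs with an honest leader exceeds the number of adversarial leaders. -/
structure IsCut (h z : ℕ → ℕ) (j : ℕ) : Prop where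
  pos : 0 < j
  honest : h j = 1
  adversarial : z j = 0
  lt : ∀ s < j, ∀ r, j ≤ r → ∑ t ∈ Finset.Icc s r, z t < ∑ t ∈ Finset.Ioc s r, min (h t) 1

namespace Execution

open BlockDAG

variable {Node Block Tx : Type*} {E : Execution Node Block Tx} {h z : ℕ → ℕ}

namespace Admissible

theorem isChain (hE : E.Admissible h z) (n : Node) (r : ℕ) : E.IsChain h z (E.chain n r) :=
  (hE.fork_choice n r).1.1

theorem weight_le (hE : E.Admissible h z) {n : Node} {r : ℕ} {C : List (Finset Block)}
    (hC : E.IsChain h z C) (hV : ∀ B, InChain B C → B ∈ E.view n r) :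
    weight C ≤ weight (E.chain n r) :=
  (hE.fork_choice n r).2 C hC hV

theorem mem_view (hE : E.Admissible h z) {n : Node} {r : ℕ} {B : Block}
    (hB : InChain B (E.chain n r)) (n' : Node) : B ∈ E.view n' (r + 1) :=
  hE.rebroadcast n n' r ((hE.fork_choice n r).1.2 B hB)

/-- Honest blocks of one epoch with a common parent tipset reach everyone in that epoch. -/
theorem weight_owner_add_card_le (hE : E.Admissible h z) (r : ℕ) (n n' : Node) (T : Finset Block)
    (hT : E.IsTipset T)
    (hm : ∀ B ∈ T, ∃ k < h (r + 1), B = E.mined (r + 1) k)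
    (hp : ∀ B ∈ T, (E.chain n r).getLast? = some (E.parents B)) :
    weight (E.chain n r) + T.card ≤ weight (E.chain n' (r + 1)) := by
  obtain ⟨A, hA⟩ := hT.1
  have hv : ∀ B ∈ T, B ∈ E.view n' (r + 1) := by
    intro B hB
    obtain ⟨k, hk, rfl⟩ := hm B hB
    exact hE.mined_delivered r k hk n'
  have h1 : E.IsChain h z (E.chain n r ++ [T]) := by
    refine (hE.isChain n r).concat (hp A hA) hT (fun B hB => (hE.view_valid _ _ B (hv B hB)).1) ?_
    intro B hB
    have := (hp B hB).symm.trans (hp A hA)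
    simpa using this
  have h2 := hE.weight_le (n := n') (r := r + 1) h1 ?_
  · simpa [weight] using h2
  · intro B hB
    rcases inChain_append.1 hB with hB | hB
    · exact hE.mem_view hB n'
    · obtain ⟨T', hT', hB⟩ := hB
      rw [List.mem_singleton.1 hT'] at hB
      exact hv B hB

/-- Honest leaders of one epoch may extend different chains when there are ties, so only one unit of
growth is guaranteed however many there are. -/
theorem weight_add_min_le (hE : E.Admissible h z) {w r : ℕ}
    (hw : ∀ n, w ≤ weight (E.chain n r)) (n : Node) :
    w + min (h (r + 1)) 1 ≤ weight (E.chain n (r + 1)) := by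
  rcases Nat.eq_zero_or_pos (h (r + 1)) with h0 | h0
  · have h1 := hE.weight_le (n := n) (r := r + 1) (hE.isChain n r) fun B hB => hE.mem_view hB n
    have h2 := hw n
    omega
  · have h1 := hE.weight_owner_add_card_le r (E.owner (r + 1) 0) n {E.mined (r + 1) 0}
      ⟨by simp, by simp, by simp⟩
      (by simpa using ⟨0, h0, rfl⟩) (by simpa using hE.mined_parents r 0 h0)
    have h2 := hw (E.owner (r + 1) 0)
    simp only [Finset.card_singleton] at h1
    omega

/-- The weight of adopted chains grows in every epoch with an honest leader. -/
theorem weight_add_sum_le (hE : E.Admissible h z) {w s : ℕ}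
    (hw : ∀ n, w ≤ weight (E.chain n s)) {r : ℕ} (hr : s ≤ r) (n : Node) :
    w + ∑ t ∈ Finset.Ioc s r, min (h t) 1 ≤ weight (E.chain n r) := by
  induction r, hr using Nat.le_induction generalizing n with
  | base => simpa using hw n
  | succ r hr ih =>
    rw [Finset.sum_Ioc_succ_top (by omega), ← add_assoc]
    exact hE.weight_add_min_le ih n

theorem eq_mined (hE : E.Admissible h z) {n : Node} {r : ℕ} {B : Block} (hB : B ∈ E.view n r)
    (hne : B ≠ E.genesis) (hh : E.Honest B) :
    ∃ s k, E.epoch B = s + 1 ∧ k < h (s + 1) ∧ B = E.mined (s + 1) k := by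
  obtain ⟨e, k, hk⟩ := hh.resolve_left hne
  obtain ⟨h1, h2, ⟨⟨P, hP⟩, -⟩, h4⟩ := (hE.view_valid n r B hB).1.of_ne_genesis hne
  have h5 := h4 P hP
  rw [hk] at h1 h2
  simp only [Ticket.epoch, Ticket.Wins] at h1 h2
  -- A parent of smaller epoch exists, so the epoch is positive and the rules for `mined (s + 1)`
  -- apply.
  obtain ⟨s, rfl⟩ : ∃ s, e = s + 1 := ⟨e - 1, by omega⟩
  exact ⟨s, k, h1.symm, h2, hE.no_forgery n r B hB hne _ k hk⟩

/-- Everything up to `T`, its adversarial blocks excepted, is available to all nodes at epoch `s`,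
and honest growth adds to that weight until `r`. The chain itself can add only adversarial blocks:
those of `T`, at most `z s`, and those of `Q`. This is why the adversarial sum includes epoch `s`
and the honest one does not. -/
theorem weight_bound (hE : E.Admissible h z) {n : Node} {r s : ℕ} {P Q : List (Finset Block)}
    {T : Finset Block} {B : Block} (hC : E.chain n r = P ++ T :: Q) (hB : B ∈ T)
    (hBs : E.epoch B = s) (hBh : E.Honest B) (hQ : ∀ S ∈ Q, ¬ ∃ B ∈ S, E.Honest B) :
    ∑ t ∈ Finset.Ioc s r, min (h t) 1 ≤ ∑ t ∈ Finset.Icc s r, z t := by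
  classical
  have hch := hE.isChain n r
  have hvw : ∀ B, InChain B (E.chain n r) → B ∈ E.view n r := (hE.fork_choice n r).1.2
  rw [hC] at hch hvw
  have hT := hch.2.1 T (by simp)
  have hep : ∀ B ∈ T, E.epoch B = s := fun B' hB' => by rw [← hBs]; exact (hT.1.2.1 B' hB' B hB).1
  have hTv : ∀ B ∈ T, B ∈ E.view n r := fun B hB => hvw B ⟨T, by simp, hB⟩
  have hsr : s ≤ r := hBs ▸ (hE.view_valid n r B (hTv B hB)).2
  have hQw : weight Q ≤ ∑ t ∈ Finset.Ioc s r, z t := by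
    refine weight_le_sum_of_not_honest Q T s (fun S hS => hch.2.1 S (List.mem_append_right _ hS))
      (List.isChain_append.1 hch.2.2).2.1 hep fun S hS B hB => ⟨fun hh => hQ S hS ⟨B, hB, hh⟩, ?_⟩
    exact (hE.view_valid n r B (hvw B ⟨S, by simp [hS], hB⟩)).2
  have hadv : (T.filter fun B => ¬ E.Honest B).card ≤ z s :=
    card_filter_not_honest_le hT.1 hT.2 hep
  have hcard : (T.filter E.Honest).card + (T.filter fun B => ¬ E.Honest B).card = T.card :=
    Finset.card_filter_add_card_filter_not _
  have hpre : ∀ n', weight P + (T.filter E.Honest).card ≤ weight (E.chain n' s) := by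
    intro n'
    by_cases hP : P = []
    · subst hP
      have hg : T = {E.genesis} := hch.head_eq
      subst hg
      have hch' : E.IsChain h z ([] ++ [{E.genesis}]) :=
        hch.of_append (P := [] ++ [{E.genesis}]) (Q := Q) (by simp)
      have h1 := hE.weight_le (n := n') (r := s) hch' ?_
      · refine le_trans ?_ h1
        simp only [weight, List.nil_append, List.map_cons, List.map_nil, List.sum_cons, List.sum_nil]
        simpa using Finset.card_filter_le {E.genesis} E.Honest
      · rintro B' ⟨T', hT', hB'⟩
        simp only [List.nil_append, List.mem_singleton] at hT'
        subst hT'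
        rw [Finset.mem_singleton.1 hB']
        exact hE.genesis_mem n' s
    · obtain ⟨s', k, h1, hk, rfl⟩ := hE.eq_mined (hTv B hB) (hch.ne_genesis hP hB) hBh
      have hs' : s = s' + 1 := hBs.symm.trans h1
      -- A chain is determined by its last tipset, so the parents of `B` identify `P` with the chain
      -- its maker had adopted.
      have hPe : P = E.chain (E.owner (s' + 1) k) s' := by
        refine (hch.of_append hP).eq_of_getLast? (hE.isChain _ _) ?_
        rw [hch.getLast?_eq_parents hP hB, hE.mined_parents s' k hk]
      rw [hPe, hs']
      refine hE.weight_owner_add_card_le s' _ n' (T.filter E.Honest) ?_ ?_ ?_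
      · exact ⟨⟨_, Finset.mem_filter.2 ⟨hB, hBh⟩⟩,
          fun A hA A' hA' => hT.1.2.1 A (Finset.mem_filter.1 hA).1 A' (Finset.mem_filter.1 hA').1,
          hT.1.2.2.mono (Finset.coe_subset.2 (Finset.filter_subset _ _))⟩
      · intro A hA
        rw [Finset.mem_filter] at hA
        obtain ⟨a, l, ha, hl, he⟩ := hE.eq_mined (hTv A hA.1) (hch.ne_genesis hP hA.1) hA.2
        have : a = s' := by have := hep A hA.1; omega
        subst this
        exact ⟨l, hl, he⟩
      · intro A hA
        rw [← hPe]
        exact hch.getLast?_eq_parents hP (Finset.mem_filter.1 hA).1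
  have hgrow := hE.weight_add_sum_le hpre hsr n
  rw [hC, weight_append, weight_cons] at hgrow
  have hsum : ∑ t ∈ Finset.Icc s r, z t = z s + ∑ t ∈ Finset.Ioc s r, z t := by
    rw [← Finset.Ioc_insert_left hsr, Finset.sum_insert (by simp)]
  omega

/-- From a cut epoch on, every adopted chain contains the honest block of that epoch, alone in its
tipset. -/
theorem exists_append_cons_mined (hE : E.Admissible h z) {j : ℕ} (hj : IsCut h z j) (n : Node)
    (r : ℕ) (hr : j ≤ r) : ∃ P Q, P ≠ [] ∧ E.chain n r = P ++ {E.mined j 0} :: Q := by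
  induction r using Nat.strong_induction_on generalizing n with
  | _ r ih =>
    have hch := hE.isChain n r
    have hvw : ∀ B, InChain B (E.chain n r) → B ∈ E.view n r := (hE.fork_choice n r).1.2
    obtain ⟨P, T, Q, hC, ⟨B, hB, hBh⟩, hQ⟩ : ∃ P T Q, E.chain n r = P ++ T :: Q ∧
        (∃ B ∈ T, E.Honest B) ∧ ∀ S ∈ Q, ¬ ∃ B ∈ S, E.Honest B := by
      refine List.exists_append_cons_forall_not
        ⟨{E.genesis}, List.mem_of_head? hch.1, E.genesis, by simp, Or.inl rfl⟩
    have hTv : ∀ B ∈ T, B ∈ E.view n r := fun B hB => hvw B ⟨T, by simp [hC], hB⟩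
    have hBr := (hE.view_valid n r B (hTv B hB)).2
    rw [hC] at hch
    have hT := hch.2.1 T (by simp)
    -- An epoch before `j` contradicts the cut by `weight_bound`. In epoch `j` itself there is just
    -- one election, so `T` is the singleton wanted. After `j`, the part below `T` was adopted by an
    -- honest node at an earlier epoch that is still at least `j`, and induction applies.
    rcases lt_or_ge (E.epoch B) j with hlt | hge
    · have h1 := hE.weight_bound hC hB rfl hBh hQ
      have h2 := hj.lt _ hlt r hr
      omega
    have hBne : B ≠ E.genesis := by
      rintro rfl
      have := E.genesis_epoch
      have := hj.pos
      omega
    have hP : P ≠ [] := by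
      rintro rfl
      have := hch.head_eq
      subst this
      exact hBne (Finset.mem_singleton.1 hB)
    obtain ⟨s, k, hs, hk, hBe⟩ := hE.eq_mined (hTv B hB) hBne hBh
    rcases hge.eq_or_lt with heq | hlt
    · refine ⟨P, Q, hP, ?_⟩
      rw [hC]
      suffices T = {E.mined j 0} by rw [this]
      refine Finset.eq_singleton_iff_nonempty_unique_mem.2 ⟨hT.1.1, fun A hA => ?_⟩
      have hAe : E.epoch A = j := by rw [heq]; exact (hT.1.2.1 A hA B hB).1
      have hAne : A ≠ E.genesis := hch.ne_genesis hP hA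
      have hAh : E.Honest A := by
        obtain ⟨h1, h2, -⟩ := (hT.2 A hA).of_ne_genesis hAne
        cases ht : E.ticket A with
        | honest e k => exact Or.inr ⟨e, k, ht⟩
        | adversarial e k =>
          rw [ht] at h1 h2
          simp only [Ticket.epoch, Ticket.Wins] at h1 h2
          rw [h1, hAe, hj.adversarial] at h2
          omega
      obtain ⟨a, l, ha, hl, he⟩ := hE.eq_mined (hTv A hA) hAne hAh
      have haj : a + 1 = j := by omega
      rw [haj] at hl he
      rw [hj.honest] at hl
      rw [he, Nat.lt_one_iff.1 hl]
    · have hPe : P = E.chain (E.owner (s + 1) k) s := by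
        refine (hch.of_append hP).eq_of_getLast? (hE.isChain _ _) ?_
        rw [hch.getLast?_eq_parents hP hB, hBe, hE.mined_parents s k hk]
      obtain ⟨P', Q', hP', he⟩ := ih s (by omega) (E.owner (s + 1) k) (by omega)
      refine ⟨P', Q' ++ T :: Q, hP', ?_⟩
      rw [hC, hPe, he]
      simp

/-- From a cut epoch on, every adopted chain extends the chain that ends in the honest block of
that epoch. -/
theorem chain_owner_append_prefix (hE : E.Admissible h z) {j : ℕ} (hj : IsCut h z (j + 1))
    (n : Node) (r : ℕ) (hr : j + 1 ≤ r) :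
    E.chain (E.owner (j + 1) 0) j ++ [{E.mined (j + 1) 0}] <+: E.chain n r := by
  obtain ⟨P, Q, hP, he⟩ := hE.exists_append_cons_mined hj n r hr
  have hch := hE.isChain n r
  rw [he] at hch
  have : P = E.chain (E.owner (j + 1) 0) j := by
    refine (hch.of_append hP).eq_of_getLast? (hE.isChain _ _) ?_
    rw [hch.getLast?_eq_parents hP (Finset.mem_singleton_self _),
      hE.mined_parents j 0 (by rw [hj.honest]; exact one_pos)]
  rw [he, this]
  exact ⟨Q, by simp⟩

theorem isChain_owner_append (hE : E.Admissible h z) {j : ℕ} (hj : IsCut h z (j + 1)) :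
    E.IsChain h z (E.chain (E.owner (j + 1) 0) j ++ [{E.mined (j + 1) 0}]) := by
  obtain ⟨Q, hQ⟩ := hE.chain_owner_append_prefix hj (E.owner (j + 1) 0) (j + 1) le_rfl
  have := hE.isChain (E.owner (j + 1) 0) (j + 1)
  rw [← hQ] at this
  exact this.of_append (by simp)

end Admissible

/-! ### Ledger positions, persistence and liveness from a cut -/

theorem IsAt.of_prefix {α : Type*} {l l' : List α} {tx : α} {p : ℕ} (hl : l <+: l')
    (h : IsAt l tx p) : IsAt l' tx p := by
  obtain ⟨m, rfl⟩ := hl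
  obtain ⟨h1, h2⟩ := h
  have hp : p < l.length := by
    by_contra hp
    rw [List.getElem?_eq_none (by omega)] at h1
    simp at h1
  refine ⟨by rw [List.getElem?_append_left hp, h1], ?_⟩
  rwa [List.take_append_of_le_length hp.le]

theorem exists_isAt {α : Type*} {l : List α} {tx : α} (h : tx ∈ l) : ∃ p, IsAt l tx p := by
  classical
  induction l with
  | nil => simp at h
  | cons a l ih =>
    by_cases ha : a = tx
    · exact ⟨0, by simp [IsAt, ha]⟩
    · obtain ⟨p, h1, h2⟩ := ih (by simpa [Ne.symm ha] using h)
      exact ⟨p + 1, by simpa [IsAt, Ne.symm ha] using ⟨h1, h2⟩⟩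

theorem IsAt.unique {α : Type*} {l : List α} {tx : α} {p q : ℕ} (hp : IsAt l tx p)
    (hq : IsAt l tx q) : p = q := by
  have key : ∀ {p q : ℕ}, IsAt l tx p → IsAt l tx q → ¬ p < q := by
    intro p q hp hq hlt
    refine hq.2 (List.mem_of_getElem? (i := p) ?_)
    rw [List.getElem?_take_of_lt hlt, hp.1]
  have := key hp hq
  have := key hq hp
  omega

/-- In a chain, epochs increase. -/
theorem _root_.ExpectedConsensus.BlockDAG.IsChain.epoch_lt {D : BlockDAG Block Tx}
    {P Q : List (Finset Block)} (hC : D.IsChain h z (P ++ Q)) {A B : Block} (hA : InChain A P)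
    (hB : InChain B Q) : D.epoch A < D.epoch B := by
  have hpw : List.Pairwise (fun S T : Finset Block => ∀ A ∈ S, ∀ B ∈ T, D.epoch A < D.epoch B)
      (P ++ Q) := by
    obtain ⟨-, h2, h3⟩ := hC
    generalize P ++ Q = C at h2 h3
    induction C with
    | nil => simp
    | cons T C ih =>
      have ih' := ih (fun S hS => h2 S (List.mem_cons_of_mem _ hS)) h3.tail
      refine List.pairwise_cons.2 ⟨?_, ih'⟩
      cases C with
      | nil => simp
      | cons T' C =>
        have h4 : ∀ A ∈ T, ∀ B ∈ T', D.epoch A < D.epoch B := fun A hA B hB =>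
          epoch_lt_of_parents (h2 T (by simp)).1.1 (List.isChain_cons_cons.1 h3).1
            (h2 T' (by simp)).2 hB hA
        intro S hS A hA B hB
        rcases List.mem_cons.1 hS with rfl | hS
        · exact h4 A hA B hB
        · obtain ⟨B', hB'⟩ := (h2 T' (by simp)).1.1
          exact (h4 A hA B' hB').trans ((List.pairwise_cons.1 ih').1 S hS B' hB' B hB)
  obtain ⟨S, hS, hA⟩ := hA
  obtain ⟨T, hT, hB⟩ := hB
  exact (List.pairwise_append.1 hpw).2.2 S hS T hT A hA B hB

/-- A confirmed block is older than the cut, hence lies in the prefix that all chains share from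
epoch `j` on, and the ledger of this prefix fixes the position. -/
theorem Admissible.persistence (hE : E.Admissible h z) {L : List (Finset Block) → List Tx}
    (hL : E.IsLedgerRule h z L) {τ : ℝ} {i j : ℕ} (hj : IsCut h z j) (hji : j ≤ i)
    (hτ : (i : ℝ) - τ < j) : E.Persistence L τ i := by
  obtain ⟨j, rfl⟩ : ∃ l, j = l + 1 := ⟨j - 1, by have := hj.pos; omega⟩
  rintro n tx p ⟨hp, B, hB, htx, hBe⟩ k hk n'
  have hpre := hE.chain_owner_append_prefix hj n i hji
  have hpre' := hE.chain_owner_append_prefix hj n' k (hji.trans hk)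
  have hch := hE.isChain_owner_append hj
  set C := E.chain (E.owner (j + 1) 0) j ++ [{E.mined (j + 1) 0}] with hCdef
  have hBC : InChain B C := by
    obtain ⟨Q, hQ⟩ := hpre
    rw [← hQ] at hB
    refine (inChain_append.1 hB).resolve_right fun hBQ => ?_
    have h1 : E.epoch (E.mined (j + 1) 0) < E.epoch B := by
      have h2 := hE.isChain n i
      rw [← hQ] at h2
      exact h2.epoch_lt ⟨{E.mined (j + 1) 0}, by simp [hCdef], by simp⟩ hBQ
    rw [(hE.mined_label j 0 (by rw [hj.honest]; exact one_pos)).1] at h1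
    have h3 : (E.epoch B : ℝ) < (j + 1 : ℕ) := hBe.trans_lt hτ
    rw [Nat.cast_lt] at h3
    omega
  obtain ⟨q, hq⟩ := exists_isAt ((hL.mem_iff C hch tx).2 ⟨B, hBC, htx⟩)
  have hqp := (hq.of_prefix (hL.append_only _ _ hch (hE.isChain n i) hpre)).unique hp
  subst hqp
  refine ⟨hq.of_prefix (hL.append_only _ _ hch (hE.isChain n' k) hpre'), B, ?_, htx, hBe.trans ?_⟩
  · obtain ⟨Q, hQ⟩ := hpre'
    rw [← hQ]
    exact inChain_append.2 (Or.inl hBC)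
  · have : (i : ℝ) ≤ k := by exact_mod_cast hk
    linarith

/-- The honest maker of the cut block knows the transaction, so it lies in that block or below it,
hence in the prefix shared from epoch `j` on. -/
theorem Admissible.liveness (hE : E.Admissible h z) {L : List (Finset Block) → List Tx}
    (hL : E.IsLedgerRule h z L) {u : ℝ} {i j : ℕ} (hj : IsCut h z j) (hij : i < j)
    (hu : (j : ℝ) ≤ i + u) : E.Liveness L u i := by
  obtain ⟨j, rfl⟩ : ∃ l, j = l + 1 := ⟨j - 1, by have := hj.pos; omega⟩
  intro tx htx
  have hch := hE.isChain_owner_append hj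
  have hpre := hE.chain_owner_append_prefix hj
  have hmem : E.TxInChain tx (E.chain (E.owner (j + 1) 0) j ++ [{E.mined (j + 1) 0}]) := by
    by_cases hc : E.TxInChain tx (E.chain (E.owner (j + 1) 0) j)
    · obtain ⟨B, hB, htB⟩ := hc
      exact ⟨B, inChain_append.2 (Or.inl hB), htB⟩
    · refine ⟨E.mined (j + 1) 0, inChain_append.2 (Or.inr ⟨_, List.mem_singleton_self _, by simp⟩),
        hE.mined_payload j 0 (by rw [hj.honest]; exact one_pos) tx ?_ hc⟩
      exact hE.received_mono _ (Nat.lt_succ_iff.1 hij) (htx _)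
  obtain ⟨p, hp⟩ := exists_isAt ((hL.mem_iff _ hch tx).2 hmem)
  refine ⟨p, fun k hk n => hp.of_prefix (hL.append_only _ _ hch (hE.isChain n k) (hpre n k ?_))⟩
  have : ((j + 1 : ℕ) : ℝ) ≤ k := hu.trans hk
  exact_mod_cast this

/-- Before epoch `τ` nothing is confirmed. -/
theorem persistence_of_lt {L : List (Finset Block) → List Tx} {τ : ℝ} {i : ℕ} (hi : (i : ℝ) < τ) :
    E.Persistence L τ i := by
  rintro n tx p ⟨-, B, -, -, hB⟩
  have : (0 : ℝ) ≤ E.epoch B := Nat.cast_nonneg _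
  linarith

end Execution

open MeasureTheory ProbabilityTheory
open scoped ENNReal

/-! ### Independent coordinates and a Chernoff bound -/

section IndepCoords

variable {Ω α : Type*} [MeasurableSpace Ω] {μ : Measure Ω} {X : Ω → ℕ → α}

/-- Functions of disjoint finite sets of coordinates of the random sequence `X` are measurable
and independent, as far as their expectations are concerned. -/
structure IndepCoords (μ : Measure Ω) (X : Ω → ℕ → α) : Prop where
  aemeasurable : ∀ (S : Finset ℕ) (f : (ℕ → α) → ℝ≥0∞), DependsOn f (S : Set ℕ) →
    AEMeasurable (fun ω => f (X ω)) μ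
  lintegral_mul : ∀ (S T : Finset ℕ) (f g : (ℕ → α) → ℝ≥0∞), Disjoint S T →
    DependsOn f (S : Set ℕ) → DependsOn g (T : Set ℕ) →
    ∫⁻ ω, f (X ω) * g (X ω) ∂μ = (∫⁻ ω, f (X ω) ∂μ) * ∫⁻ ω, g (X ω) ∂μ

theorem _root_.DependsOn.map₂ {ι : Type*} {π : ι → Type*} {β γ δ : Type*} {f : (∀ i, π i) → β}
    {g : (∀ i, π i) → γ} {s t : Set ι} (hf : DependsOn f s) (hg : DependsOn g t) (F : β → γ → δ) :
    DependsOn (fun x => F (f x) (g x)) (s ∪ t) := fun _ _ hxy => by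
  dsimp only
  rw [hf fun i hi => hxy i (Or.inl hi), hg fun i hi => hxy i (Or.inr hi)]

open Classical in
theorem _root_.DependsOn.ite {ι : Type*} {π : ι → Type*} {β : Type*} {P : (∀ i, π i) → Prop}
    {s : Set ι} (hP : DependsOn P s) (a b : β) :
    DependsOn (fun x => if P x then a else b) s := fun _ _ hxy => by
  dsimp only
  rw [hP hxy]

theorem _root_.DependsOn.prod {ι κ : Type*} {π : ι → Type*} {β : Type*} [CommMonoid β]
    (B : Finset κ) (f : κ → (∀ i, π i) → β) (s : κ → Set ι) (hf : ∀ b ∈ B, DependsOn (f b) (s b)) :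
    DependsOn (fun x => ∏ b ∈ B, f b x) (⋃ b ∈ B, s b) := fun _ _ hxy =>
  Finset.prod_congr rfl fun b hb => hf b hb fun i hi => hxy i (Set.mem_biUnion hb hi)

namespace IndepCoords

theorem nullMeasurableSet (hX : IndepCoords μ X) {S : Finset ℕ} {P : (ℕ → α) → Prop}
    (hP : DependsOn P (S : Set ℕ)) : NullMeasurableSet {ω | P (X ω)} μ := by
  classical
  have h1 := hX.aemeasurable S _ (hP.ite (1 : ℝ≥0∞) 0)
  convert h1.nullMeasurableSet_preimage (measurableSet_singleton 1) using 1
  ext ω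
  simp

theorem lintegral_ite (hX : IndepCoords μ X) {S : Finset ℕ} {P : (ℕ → α) → Prop}
    [DecidablePred P] (hP : DependsOn P (S : Set ℕ)) :
    ∫⁻ ω, (if P (X ω) then 1 else 0) ∂μ = μ {ω | P (X ω)} := by
  rw [← lintegral_indicator_one₀ (hX.nullMeasurableSet hP)]
  refine lintegral_congr fun ω => ?_
  by_cases h : P (X ω) <;> simp [h]

theorem measure_and (hX : IndepCoords μ X) {S T : Finset ℕ} (hST : Disjoint S T)
    {P Q : (ℕ → α) → Prop} (hP : DependsOn P (S : Set ℕ)) (hQ : DependsOn Q (T : Set ℕ)) :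
    μ {ω | P (X ω) ∧ Q (X ω)} = μ {ω | P (X ω)} * μ {ω | Q (X ω)} := by
  classical
  rw [← hX.lintegral_ite hP, ← hX.lintegral_ite hQ,
    ← hX.lintegral_mul S T (fun x => if P x then 1 else 0) (fun x => if Q x then 1 else 0) hST
      (by convert hP.ite (1 : ℝ≥0∞) 0) (by convert hQ.ite (1 : ℝ≥0∞) 0),
    ← hX.lintegral_ite (S := S ∪ T) (P := fun x => P x ∧ Q x)
      (by rw [Finset.coe_union]; exact hP.map₂ hQ And)]
  congr with ω
  by_cases h1 : P (X ω) <;> by_cases h2 : Q (X ω) <;> simp [h1, h2]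

theorem lintegral_prod [IsProbabilityMeasure μ] (hX : IndepCoords μ X) {κ : Type*} (B : Finset κ)
    (f : κ → (ℕ → α) → ℝ≥0∞) (S : κ → Finset ℕ) (hf : ∀ b ∈ B, DependsOn (f b) (S b : Set ℕ))
    (hS : (B : Set κ).PairwiseDisjoint S) :
    ∫⁻ ω, ∏ b ∈ B, f b (X ω) ∂μ = ∏ b ∈ B, ∫⁻ ω, f b (X ω) ∂μ := by
  classical
  induction B using Finset.induction_on with
  | empty => simp
  | insert b B hb ih =>
    have ih' := ih (fun c hc => hf c (Finset.mem_insert_of_mem hc))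
      (hS.subset (by simp))
    simp_rw [Finset.prod_insert hb]
    rw [← ih', hX.lintegral_mul (S b) (B.biUnion S) (f b) (fun x => ∏ b ∈ B, f b x) ?_
      (hf b (Finset.mem_insert_self _ _))]
    · rw [Finset.coe_biUnion]
      exact DependsOn.prod B f (fun b => (S b : Set ℕ)) fun c hc => hf c (Finset.mem_insert_of_mem hc)
    · rw [Finset.disjoint_biUnion_right]
      intro c hc
      exact hS (by simp) (by simp [hc]) (by rintro rfl; exact hb hc)

open Classical in
/-- Among `N` independent events of probability at least `p`, fewer than `k` occur with
exponentially small probability. -/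
theorem measure_card_lt_le [IsProbabilityMeasure μ] (hX : IndepCoords μ X) (N k : ℕ)
    (P : ℕ → (ℕ → α) → Prop) (S : ℕ → Finset ℕ) (hP : ∀ b, DependsOn (P b) (S b : Set ℕ))
    (hS : ((Finset.range N : Finset ℕ) : Set ℕ).PairwiseDisjoint S) {p : ℝ≥0∞}
    (hp : ∀ b ∈ Finset.range N, p ≤ μ {ω | P b (X ω)}) :
    μ {ω | ((Finset.range N).filter fun b => P b (X ω)).card < k} ≤
      2 ^ k * (1 - p / 2) ^ N := by
  -- Each occurrence costs a factor one half: fewer than `k` occurrences keep the product at least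
  -- `2⁻¹ ^ k`, and Markov's inequality applies.
  set f : ℕ → (ℕ → α) → ℝ≥0∞ := fun b x => if P b x then 2⁻¹ else 1
  have hf : ∀ b, DependsOn (f b) (S b : Set ℕ) := fun b => (hP b).ite _ _
  have hE : ∀ b ∈ Finset.range N, ∫⁻ ω, f b (X ω) ∂μ ≤ 1 - p / 2 := by
    intro b hb
    have h1 : ∫⁻ ω, f b (X ω) + 2⁻¹ * (if P b (X ω) then 1 else 0) ∂μ = 1 := by
      have : ∀ ω, f b (X ω) + 2⁻¹ * (if P b (X ω) then 1 else 0) = 1 := by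
        intro ω
        by_cases h : P b (X ω) <;> simp [f, h, ENNReal.inv_two_add_inv_two]
      rw [lintegral_congr this]
      simp
    rw [lintegral_add_left' (hX.aemeasurable _ _ (hf b)), lintegral_const_mul' _ _ (by simp),
      hX.lintegral_ite (hP b)] at h1
    refine ENNReal.le_sub_of_add_le_right ?_ ?_
    · exact ENNReal.div_ne_top ((hp b hb).trans_lt (measure_lt_top _ _)).ne (by simp)
    · rw [← h1, div_eq_mul_inv, mul_comm p]
      gcongr
      exact hp b hb
  have hprod : ∫⁻ ω, ∏ b ∈ Finset.range N, f b (X ω) ∂μ ≤ (1 - p / 2) ^ N := by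
    rw [hX.lintegral_prod _ f S (fun b _ => hf b) hS]
    calc _ ≤ ∏ b ∈ Finset.range N, (1 - p / 2) := Finset.prod_le_prod' hE
      _ = _ := by simp
  have hmeas : AEMeasurable (fun ω => ∏ b ∈ Finset.range N, f b (X ω)) μ :=
    Finset.aemeasurable_fun_prod _ fun b _ => hX.aemeasurable _ _ (hf b)
  have hmk := mul_meas_ge_le_lintegral₀ hmeas ((2⁻¹ : ℝ≥0∞) ^ k)
  have hsub : {ω | ((Finset.range N).filter fun b => P b (X ω)).card < k} ⊆
      {ω | (2⁻¹ : ℝ≥0∞) ^ k ≤ ∏ b ∈ Finset.range N, f b (X ω)} := by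
    intro ω hω
    simp only [Set.mem_ofPred_eq, f] at hω ⊢
    rw [Finset.prod_ite]
    simp only [Finset.prod_const, one_pow, mul_one]
    exact pow_le_pow_right_of_le_one' (ENNReal.inv_le_one.2 (by norm_num)) hω.le
  calc _ ≤ μ {ω | (2⁻¹ : ℝ≥0∞) ^ k ≤ ∏ b ∈ Finset.range N, f b (X ω)} := measure_mono hsub
    _ = 2 ^ k * (2⁻¹ ^ k * μ {ω | (2⁻¹ : ℝ≥0∞) ^ k ≤ ∏ b ∈ Finset.range N, f b (X ω)}) := by
      rw [← mul_assoc, ← mul_pow, ENNReal.mul_inv_cancel (by simp) (by simp), one_pow, one_mul]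
    _ ≤ _ := by gcongr; exact hmk.trans hprod

end IndepCoords

end IndepCoords

/-! ### The reflected multiplicative walk -/

section MaxProd

variable {α : Type*}

/-- The largest product of `φ` over a run of consecutive terms of `y` that ends before time `t`. -/
noncomputable def maxProd (φ : α → ℝ≥0∞) (y : ℕ → α) : ℕ → ℝ≥0∞
  | 0 => 1
  | t + 1 => max 1 (maxProd φ y t * φ (y t))

theorem prod_Ico_le_maxProd (φ : α → ℝ≥0∞) (y : ℕ → α) {s t : ℕ} (hst : s ≤ t) :
    ∏ u ∈ Finset.Ico s t, φ (y u) ≤ maxProd φ y t := by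
  induction t, hst using Nat.le_induction with
  | base =>
    cases s with
    | zero => simp [maxProd]
    | succ s => simp [maxProd]
  | succ t hst ih =>
    rw [Finset.prod_Ico_succ_top hst, maxProd]
    exact le_max_of_le_right (by gcongr)

theorem dependsOn_maxProd (φ : α → ℝ≥0∞) (σ : ℕ → ℕ) (t : ℕ) :
    DependsOn (fun x : ℕ → α => maxProd φ (x ∘ σ) t) (((Finset.range t).image σ : Finset ℕ) : Set ℕ) := by
  intro x y hxy
  dsimp only
  induction t with
  | zero => rfl
  | succ t ih =>
    rw [maxProd, maxProd, ih fun i hi => hxy i ?_, Function.comp, Function.comp, hxy (σ t)]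
    · simp only [Finset.coe_image, Finset.coe_range]
      exact ⟨t, by simp, rfl⟩
    · simp only [Finset.coe_image, Finset.coe_range] at hi ⊢
      obtain ⟨a, ha, rfl⟩ := hi
      exact ⟨a, by simp at ha ⊢; omega, rfl⟩

variable {Ω : Type*} [MeasurableSpace Ω] {μ : Measure Ω} {X : Ω → ℕ → α}
  {φ : α → ℝ≥0∞} {ρ C : ℝ≥0∞} {σ : ℕ → ℕ}

theorem IndepCoords.lintegral_maxProd_mul (hX : IndepCoords μ X)
    (hφ : ∀ t, ∫⁻ ω, φ (X ω t) ∂μ ≤ ρ) (hσ : σ.Injective) (t : ℕ) (f : (ℕ → α) → ℝ≥0∞)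
    (hf : DependsOn f (((Finset.range t).image σ : Finset ℕ) : Set ℕ)) :
    ∫⁻ ω, f (X ω) * φ (X ω (σ t)) ∂μ ≤ (∫⁻ ω, f (X ω) ∂μ) * ρ := by
  rw [hX.lintegral_mul ((Finset.range t).image σ) {σ t} f (fun x => φ (x (σ t))) ?_ hf]
  · gcongr
    exact hφ _
  · intro x y hxy
    dsimp only
    rw [hxy (σ t) (by simp)]
  · simp only [Finset.disjoint_singleton_right, Finset.mem_image, Finset.mem_range, not_exists, not_and]
    intro a ha he
    have := hσ he
    omega

/-- Bounding the maximum by the sum, and using that the next factor is independent of the past, the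
mean `x` becomes at most `1 + x * ρ`; the bound `C` is stable under this map. -/
theorem IndepCoords.lintegral_maxProd_le [IsProbabilityMeasure μ] (hX : IndepCoords μ X)
    (hφ : ∀ t, ∫⁻ ω, φ (X ω t) ∂μ ≤ ρ) (hσ : σ.Injective) (hC : 1 + C * ρ ≤ C) (t : ℕ) :
    ∫⁻ ω, maxProd φ (X ω ∘ σ) t ∂μ ≤ C := by
  induction t with
  | zero => simpa [maxProd] using le_self_add.trans hC
  | succ t ih =>
    calc ∫⁻ ω, maxProd φ (X ω ∘ σ) (t + 1) ∂μ
        ≤ ∫⁻ ω, 1 + maxProd φ (X ω ∘ σ) t * φ (X ω (σ t)) ∂μ := by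
          refine lintegral_mono fun ω => ?_
          rw [maxProd]
          exact max_le le_self_add le_add_self
      _ = 1 + ∫⁻ ω, maxProd φ (X ω ∘ σ) t * φ (X ω (σ t)) ∂μ := by
          rw [lintegral_add_left measurable_const]; simp
      _ ≤ 1 + (∫⁻ ω, maxProd φ (X ω ∘ σ) t ∂μ) * ρ := by
          gcongr
          exact hX.lintegral_maxProd_mul hφ hσ t _ (dependsOn_maxProd φ σ t)
      _ ≤ 1 + C * ρ := by gcongr
      _ ≤ C := hC

theorem IndepCoords.measure_le_maxProd_le [IsProbabilityMeasure μ] (hX : IndepCoords μ X)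
    (hφ : ∀ t, ∫⁻ ω, φ (X ω t) ∂μ ≤ ρ) (hσ : σ.Injective) (hC : 1 + C * ρ ≤ C) (t : ℕ)
    (b : ℝ≥0∞) : b * μ {ω | b ≤ maxProd φ (X ω ∘ σ) t} ≤ C :=
  (mul_meas_ge_le_lintegral₀ (hX.aemeasurable _ _ (dependsOn_maxProd φ σ t)) b).trans
    (hX.lintegral_maxProd_le hφ hσ hC t)

open Classical in
/-- The time that the process `maxProd` spends above a high level has exponential tails. -/
theorem IndepCoords.measure_card_le_maxProd_le [IsProbabilityMeasure μ] (hX : IndepCoords μ X)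
    (hφ : ∀ t, ∫⁻ ω, φ (X ω t) ∂μ ≤ ρ) (hσ : σ.Injective) (hC : 1 + C * ρ ≤ C) (hρ : ρ ≤ 1)
    {b q η : ℝ≥0∞} (hq1 : 1 ≤ q) (hη : η ≠ ∞)
    (hq : ∀ u, b ≤ u → q * (1 + η + η * u * ρ) ≤ (1 + η) * (1 + η * u)) (a n k : ℕ) :
    q ^ k * μ {ω | k ≤ ((Finset.Ico a (a + n)).filter
      fun s => b ≤ maxProd φ (X ω ∘ σ) s).card} ≤ (1 + η) ^ n * (1 + η * C) := by
  set U : ℕ → (ℕ → α) → ℝ≥0∞ := fun t x => maxProd φ (x ∘ σ) t with hU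
  set W : ℕ → (ℕ → α) → ℝ≥0∞ :=
    fun n x => ∏ s ∈ Finset.Ico a (a + n), if b ≤ U s x then q else 1 with hW
  have hUd : ∀ {s t}, s ≤ t → DependsOn (U s) (((Finset.range t).image σ : Finset ℕ) : Set ℕ) :=
    fun hst => (dependsOn_maxProd φ σ _).mono
      (Finset.coe_subset.2 (Finset.image_subset_image (Finset.range_mono hst)))
  have hWd : ∀ {n t}, a + n ≤ t + 1 →
      DependsOn (W n) (((Finset.range t).image σ : Finset ℕ) : Set ℕ) := by
    intro n t hnt x y hxy
    simp only [hW]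
    refine Finset.prod_congr rfl fun s hs => ?_
    have := (Finset.mem_Ico.1 hs).2
    rw [hUd (show s ≤ t by omega) hxy]
  have hWs : ∀ n x, W (n + 1) x = W n x * if b ≤ U (a + n) x then q else 1 := by
    intro n x
    simp only [hW]
    rw [← add_assoc, Finset.prod_Ico_succ_top (by omega)]
  -- `1 + η * U` is a Lyapunov function: its conditional mean after one step is at most `1 + η + η *
  -- U * ρ`. Above level `b` the drift pays for the factor `q`; below it `ρ ≤ 1` suffices. Each step
  -- thus costs at most `1 + η` in mean.
  have hstep : ∀ n x, W (n + 1) x * (1 + η + η * U (a + n) x * ρ) ≤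
      (1 + η) * (W n x * (1 + η * U (a + n) x)) := by
    intro n x
    rw [hWs, mul_assoc, mul_left_comm (1 + η)]
    refine mul_le_mul_right ?_ (W n x)
    split_ifs with hb
    · exact hq _ hb
    · calc 1 * (1 + η + η * U (a + n) x * ρ) ≤ 1 * (1 + η + η * U (a + n) x * 1) := by gcongr
        _ ≤ 1 + η + η * U (a + n) x + η * (η * U (a + n) x) := by
          rw [one_mul, mul_one]; exact le_self_add
        _ = (1 + η) * (1 + η * U (a + n) x) := by ring
  have hmain : ∀ n, ∫⁻ ω, W n (X ω) * (1 + η * U (a + n) (X ω)) ∂μ ≤ (1 + η) ^ n * (1 + η * C) := by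
    intro n
    induction n with
    | zero =>
      have h0 : ∀ x, W 0 x = 1 := by simp [hW]
      simp only [h0, one_mul, pow_zero, add_zero]
      rw [lintegral_add_left measurable_const, lintegral_const_mul' _ _ hη]
      simp only [lintegral_const, measure_univ, mul_one]
      gcongr
      exact hX.lintegral_maxProd_le hφ hσ hC a
    | succ n ih =>
      have hd1 : DependsOn (fun x => W (n + 1) x * (1 + η))
          (((Finset.range (a + n)).image σ : Finset ℕ) : Set ℕ) := by
        intro x y hxy
        dsimp only
        rw [hWd (show a + (n + 1) ≤ a + n + 1 by omega) hxy]
      have hd2 : DependsOn (fun x => W (n + 1) x * (η * U (a + n) x))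
          (((Finset.range (a + n)).image σ : Finset ℕ) : Set ℕ) := by
        intro x y hxy
        dsimp only
        rw [hWd (show a + (n + 1) ≤ a + n + 1 by omega) hxy, hUd le_rfl hxy]
      calc ∫⁻ ω, W (n + 1) (X ω) * (1 + η * U (a + (n + 1)) (X ω)) ∂μ
          ≤ ∫⁻ ω, W (n + 1) (X ω) * (1 + η) +
              W (n + 1) (X ω) * (η * U (a + n) (X ω)) * φ (X ω (σ (a + n))) ∂μ := by
            refine lintegral_mono fun ω => ?_
            dsimp only
            rw [mul_assoc, ← mul_add, add_assoc 1, mul_assoc η, ← mul_one_add η]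
            gcongr
            rw [← add_assoc]
            exact max_le le_self_add le_add_self
        _ = ∫⁻ ω, W (n + 1) (X ω) * (1 + η) ∂μ +
              ∫⁻ ω, W (n + 1) (X ω) * (η * U (a + n) (X ω)) * φ (X ω (σ (a + n))) ∂μ :=
            lintegral_add_left' (hX.aemeasurable _ _ hd1) _
        _ ≤ ∫⁻ ω, W (n + 1) (X ω) * (1 + η) ∂μ +
              (∫⁻ ω, W (n + 1) (X ω) * (η * U (a + n) (X ω)) ∂μ) * ρ := by
            gcongr
            exact hX.lintegral_maxProd_mul hφ hσ _ _ hd2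
        _ = ∫⁻ ω, W (n + 1) (X ω) * (1 + η + η * U (a + n) (X ω) * ρ) ∂μ := by
            rw [← lintegral_mul_const' _ _ (hρ.trans_lt ENNReal.one_lt_top).ne,
              ← lintegral_add_left' (hX.aemeasurable _ _ hd1)]
            congr with ω
            ring
        _ ≤ ∫⁻ ω, (1 + η) * (W n (X ω) * (1 + η * U (a + n) (X ω))) ∂μ :=
            lintegral_mono fun ω => hstep n (X ω)
        _ = (1 + η) * ∫⁻ ω, W n (X ω) * (1 + η * U (a + n) (X ω)) ∂μ :=
            lintegral_const_mul' _ _ (by finiteness)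
        _ ≤ (1 + η) * ((1 + η) ^ n * (1 + η * C)) := by gcongr
        _ = _ := by ring
  have hsub : {ω | k ≤ ((Finset.Ico a (a + n)).filter
      fun s => b ≤ maxProd φ (X ω ∘ σ) s).card} ⊆ {ω | q ^ k ≤ W n (X ω)} := by
    intro ω hω
    simp only [Set.mem_ofPred_eq, hW] at hω ⊢
    rw [Finset.prod_ite]
    simp only [Finset.prod_const, one_pow, mul_one]
    exact pow_le_pow_right' hq1 hω
  calc _ ≤ q ^ k * μ {ω | q ^ k ≤ W n (X ω)} := by gcongr
    _ ≤ ∫⁻ ω, W n (X ω) ∂μ :=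
      mul_meas_ge_le_lintegral₀ (hX.aemeasurable _ _ (hWd (Nat.le_succ (a + n)))) _
    _ ≤ ∫⁻ ω, W n (X ω) * (1 + η * U (a + n) (X ω)) ∂μ :=
      lintegral_mono fun ω => le_mul_of_one_le_right' le_self_add
    _ ≤ _ := hmain n

end MaxProd

/-! ### Local cuts of a walk and violations at long range -/

section WalkCut

variable {α : Type*}

/-- The reflection of the integers `0, …, T`, extended by the identity. -/
def reflect (T t : ℕ) : ℕ := if t ≤ T then T - t else t

theorem reflect_injective (T : ℕ) : (reflect T).Injective := by
  intro a b h
  simp only [reflect] at h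
  split_ifs at h <;> omega

/-- Time reversal about the horizon `T` turns runs starting just after `j` into runs ending before
`T - j`, so the same walk controls past and future. -/
theorem prod_Ioc_le_maxProd_reflect (φ : α → ℝ≥0∞) (y : ℕ → α) {j r T : ℕ} (hjr : j ≤ r)
    (hrT : r ≤ T) : ∏ t ∈ Finset.Ioc j r, φ (y t) ≤ maxProd φ (y ∘ reflect T) (T - j) := by
  refine le_trans (le_of_eq ?_)
    (prod_Ico_le_maxProd φ (y ∘ reflect T) (show T - r ≤ T - j by omega))
  refine Finset.prod_nbij' (fun t => T - t) (fun t => T - t) ?_ ?_ ?_ ?_ ?_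
  · intro t ht
    simp only [Finset.mem_Ioc, Finset.mem_Ico] at ht ⊢
    omega
  · intro t ht
    simp only [Finset.mem_Ioc, Finset.mem_Ico] at ht ⊢
    omega
  · intro t ht
    simp only [Finset.mem_Ioc] at ht
    omega
  · intro t ht
    simp only [Finset.mem_Ico] at ht
    omega
  · intro t ht
    simp only [Finset.mem_Ioc] at ht
    simp only [Function.comp, reflect]
    rw [if_pos (by omega), Nat.sub_sub_self (by omega)]

/-- At a cut the walk with the given steps reaches a new maximum, below which it never falls
again. The predicate looks `K` steps to either side only. -/
structure IsLocalCut (step : α → ℤ) (good : α → Prop) (K : ℕ) (y : ℕ → α) (j : ℕ) : Prop where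
  good : good (y j)
  left : ∀ s, s < j → j ≤ s + K → 1 ≤ ∑ t ∈ Finset.Ico s j, step (y t)
  right : ∀ r, r ≤ j + K → 0 ≤ ∑ t ∈ Finset.Ioc j r, step (y t)

theorem dependsOn_isLocalCut (step : α → ℤ) (good : α → Prop) {K j : ℕ} :
    DependsOn (fun y : ℕ → α => IsLocalCut step good K y j)
      ((Finset.Icc (j - K) (j + K) : Finset ℕ) : Set ℕ) := by
  have key : ∀ x y : ℕ → α, (∀ i ∈ ((Finset.Icc (j - K) (j + K) : Finset ℕ) : Set ℕ), x i = y i) →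
      IsLocalCut step good K x j → IsLocalCut step good K y j := by
    intro x y hxy h
    simp only [Finset.mem_coe, Finset.mem_Icc] at hxy
    refine ⟨?_, fun s hs hs' => ?_, fun r hr => ?_⟩
    · rw [← hxy j (by omega)]
      exact h.good
    · rw [← Finset.sum_congr rfl fun t ht => congrArg step (hxy t ?_)]
      · exact h.left s hs hs'
      · rw [Finset.mem_Ico] at ht
        omega
    · rw [← Finset.sum_congr rfl fun t ht => congrArg step (hxy t ?_)]
      · exact h.right r hr
      · rw [Finset.mem_Ioc] at ht
        omega
  intro x y hxy
  exact propext ⟨key x y hxy, key y x fun i hi => (hxy i hi).symm⟩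

/-- The exponential weight of a step, which has mean below one for a suitable tilt `l` and a
slack `δ` smaller than the drift. -/
noncomputable def tilt (step : α → ℤ) (l δ : ℝ) (a : α) : ℝ≥0∞ :=
  ENNReal.ofReal (Real.exp (l * (δ - step a)))

theorem prod_tilt (step : α → ℤ) (l δ : ℝ) (y : ℕ → α) (S : Finset ℕ) :
    ∏ t ∈ S, tilt step l δ (y t) =
      ENNReal.ofReal (Real.exp (l * (δ * S.card - (∑ t ∈ S, step (y t) : ℤ)))) := by
  simp only [tilt]
  rw [← ENNReal.ofReal_prod_of_nonneg fun _ _ => (Real.exp_pos _).le, ← Real.exp_sum]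
  congr 2
  rw [← Finset.mul_sum, Finset.sum_sub_distrib]
  simp [mul_comm]

theorem le_prod_tilt {step : α → ℤ} {l δ : ℝ} (hl : 0 ≤ l) {y : ℕ → α}
    {S : Finset ℕ} {v : ℝ} (h : v ≤ δ * S.card - (∑ t ∈ S, step (y t) : ℤ)) :
    ENNReal.ofReal (Real.exp (l * v)) ≤ ∏ t ∈ S, tilt step l δ (y t) := by
  rw [prod_tilt]
  gcongr

/-- The slack `δ` pays for length: a run of more than `K` steps without gain has tilted weight at
least exponential in `K`. -/
theorem le_maxProd_of_sum_nonpos {step : α → ℤ} {l δ : ℝ} (hl : 0 ≤ l) (hδ : 0 ≤ δ) {y : ℕ → α}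
    {K s j : ℕ} (hs : s + K < j) (h : ∑ t ∈ Finset.Ico s j, step (y t) ≤ 0) :
    ENNReal.ofReal (Real.exp (l * (δ * K))) ≤ maxProd (tilt step l δ) y j := by
  refine (le_prod_tilt hl ?_).trans (prod_Ico_le_maxProd _ y (show s ≤ j by omega))
  have h1 : ((∑ t ∈ Finset.Ico s j, step (y t) : ℤ) : ℝ) ≤ 0 := by exact_mod_cast h
  have h2 : (K : ℝ) ≤ ((Finset.Ico s j).card : ℝ) := by
    rw [Nat.card_Ico]
    exact_mod_cast (by omega : K ≤ j - s)
  nlinarith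

theorem le_maxProd_reflect_of_sum_neg {step : α → ℤ} {l δ : ℝ} (hl : 0 ≤ l) (hδ : 0 ≤ δ)
    {y : ℕ → α} {K r j T : ℕ} (hr : j + K < r) (hrT : r ≤ T)
    (h : ∑ t ∈ Finset.Ioc j r, step (y t) < 0) :
    ENNReal.ofReal (Real.exp (l * (δ * K))) ≤ maxProd (tilt step l δ) (y ∘ reflect T) (T - j) := by
  refine (le_prod_tilt hl ?_).trans
    (prod_Ioc_le_maxProd_reflect _ y (show j ≤ r by omega) hrT)
  have h1 : ((∑ t ∈ Finset.Ioc j r, step (y t) : ℤ) : ℝ) ≤ 0 := by exact_mod_cast h.le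
  have h2 : (K : ℝ) ≤ ((Finset.Ioc j r).card : ℝ) := by
    rw [Nat.card_Ioc]
    exact_mod_cast (by omega : K ≤ r - j)
  nlinarith

/-- The `M` good steps on either side of `j` gain `M`, which outweighs the losses beyond them, each
strictly less than `M`. -/
theorem IsLocalCut.of_pattern {step : α → ℤ} {good : α → Prop} (hgood : ∀ a, good a → step a = 1)
    {M K j : ℕ} (hMj : M ≤ j) {y : ℕ → α}
    (hmid : ∀ t ∈ Finset.Icc (j - M) (j + M), good (y t))
    (hleft : ∀ s ≤ j - M, -(M : ℤ) < ∑ t ∈ Finset.Ico s (j - M), step (y t))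
    (hright : ∀ r ≤ j + K, -(M : ℤ) < ∑ t ∈ Finset.Ioc (j + M) r, step (y t)) :
    IsLocalCut step good K y j := by
  have hone : ∀ S ⊆ Finset.Icc (j - M) (j + M), ∑ t ∈ S, step (y t) = S.card := by
    intro S hS
    rw [Finset.sum_congr rfl fun t ht => hgood _ (hmid t (hS ht))]
    simp
  refine ⟨hmid j (by rw [Finset.mem_Icc]; omega), fun s hs _ => ?_, fun r hr => ?_⟩
  · rcases le_total s (j - M) with h | h
    · rw [← Finset.sum_Ico_consecutive _ h (Nat.sub_le j M), hone (Finset.Ico (j - M) j),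
        Nat.card_Ico]
      · have := hleft s h
        omega
      · intro t ht
        rw [Finset.mem_Ico] at ht
        rw [Finset.mem_Icc]
        omega
    · rw [hone, Nat.card_Ico]
      · omega
      · intro t ht
        rw [Finset.mem_Ico] at ht
        rw [Finset.mem_Icc]
        omega
  · rcases le_total r (j + M) with h | h
    · rw [hone]
      · positivity
      · intro t ht
        rw [Finset.mem_Ioc] at ht
        rw [Finset.mem_Icc]
        omega
    · rw [← Finset.sum_Ioc_consecutive _ (Nat.le_add_right j M) h, hone, Nat.card_Ioc]
      · have := hright r hr
        omega
      · intro t ht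
        rw [Finset.mem_Ioc] at ht
        rw [Finset.mem_Icc]
        omega

variable {Ω : Type*} [MeasurableSpace Ω] {μ : Measure Ω} [IsProbabilityMeasure μ] {X : Ω → ℕ → α}
  {step : α → ℤ} {good : α → Prop} {l δ : ℝ} {ρ C p₀ : ℝ≥0∞}

theorem one_half_le_of_compl_subset {A B : Set Ω} (hAB : Aᶜ ⊆ B) (hB : μ B ≤ 2⁻¹) :
    2⁻¹ ≤ μ A := by
  have h1 : (1 : ℝ≥0∞) ≤ μ A + 2⁻¹ := by
    rw [← measure_univ (μ := μ), ← Set.union_compl_self A]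
    exact (measure_union_le _ _).trans (by gcongr; exact (measure_mono hAB).trans hB)
  rw [← ENNReal.one_sub_inv_two]
  exact tsub_le_iff_right.2 h1

/-- Local cuts have a probability that is bounded below independently of the range `K`. -/
theorem IndepCoords.le_measure_isLocalCut (hX : IndepCoords μ X)
    (hφ : ∀ t, ∫⁻ ω, tilt step l δ (X ω t) ∂μ ≤ ρ) (hC : 1 + C * ρ ≤ C)
    (hp : ∀ t, p₀ ≤ μ {ω | good (X ω t)}) (hgood : ∀ a, good a → step a = 1) (hl : 0 ≤ l)
    (hδ : 0 ≤ δ) {M K j : ℕ} (hMK : M ≤ K) (hKj : K ≤ j)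
    (hM : C ≤ ENNReal.ofReal (Real.exp (l * M)) * 2⁻¹) :
    2⁻¹ * (p₀ ^ (2 * M + 1) * 2⁻¹) ≤ μ {ω | IsLocalCut step good K (X ω) j} := by
  classical
  set bM := ENNReal.ofReal (Real.exp (l * M)) with hbM
  have hb0 : bM ≠ 0 := by simp [hbM, Real.exp_pos]
  have hbt : bM ≠ ∞ := ENNReal.ofReal_ne_top
  -- Markov's inequality; `hM` makes the level `exp (l * M)` at least twice the mean bound `C`.
  have htail : ∀ {σ : ℕ → ℕ} (_ : σ.Injective) (t : ℕ),
      μ {ω | bM ≤ maxProd (tilt step l δ) (X ω ∘ σ) t} ≤ 2⁻¹ := by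
    intro σ hσ t
    have h1 := (hX.measure_le_maxProd_le hφ hσ hC t bM).trans hM
    exact (ENNReal.mul_le_mul_iff_right hb0 hbt).1 h1
  let A : (ℕ → α) → Prop := fun y =>
    ∀ s ≤ j - M, -(M : ℤ) < ∑ t ∈ Finset.Ico s (j - M), step (y t)
  let B : (ℕ → α) → Prop := fun y => ∀ t ∈ Finset.Icc (j - M) (j + M), good (y t)
  let D : (ℕ → α) → Prop := fun y =>
    ∀ r ≤ j + K, -(M : ℤ) < ∑ t ∈ Finset.Ioc (j + M) r, step (y t)
  have hbound : ∀ {S : Finset ℕ} {y : ℕ → α}, ∑ t ∈ S, step (y t) ≤ -(M : ℤ) →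
      bM ≤ ∏ t ∈ S, tilt step l δ (y t) := by
    intro S y h
    refine le_prod_tilt hl ?_
    have h1 : ((∑ t ∈ S, step (y t) : ℤ) : ℝ) ≤ -M := by exact_mod_cast h
    have h2 : 0 ≤ δ * S.card := by positivity
    linarith
  have hA : 2⁻¹ ≤ μ {ω | A (X ω)} := by
    refine one_half_le_of_compl_subset ?_ (htail Function.injective_id (j - M))
    intro ω hω
    simp only [Set.mem_compl_iff, Set.mem_ofPred_eq, A, not_forall, not_lt, exists_prop] at hω ⊢
    obtain ⟨s, hs, h⟩ := hω
    exact (hbound h).trans (prod_Ico_le_maxProd _ _ hs)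
  have hD : 2⁻¹ ≤ μ {ω | D (X ω)} := by
    refine one_half_le_of_compl_subset ?_
      (htail (reflect_injective (j + K)) (j + K - (j + M)))
    intro ω hω
    simp only [Set.mem_compl_iff, Set.mem_ofPred_eq, D, not_forall, not_lt, exists_prop] at hω ⊢
    obtain ⟨r, hr, h⟩ := hω
    -- For `r` below `j + M` the interval is empty; the maximum replaces it by an empty interval
    -- with ordered endpoints.
    refine (hbound (S := Finset.Ioc (j + M) (max (j + M) r)) ?_).trans
      (prod_Ioc_le_maxProd_reflect _ _ (le_max_left _ _) (by omega))
    rcases le_total r (j + M) with h' | h'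
    · rw [max_eq_left h']
      rwa [Finset.Ioc_eq_empty (by omega)] at h ⊢
    · rwa [max_eq_right h']
  have hB : p₀ ^ (2 * M + 1) ≤ μ {ω | B (X ω)} := by
    have hd : ∀ t, DependsOn (fun y : ℕ → α => good (y t)) (({t} : Finset ℕ) : Set ℕ) :=
      fun t x y hxy => by
        dsimp only
        rw [hxy t (by simp)]
    have hBd : DependsOn B ((Finset.Icc (j - M) (j + M) : Finset ℕ) : Set ℕ) := by
      intro x y hxy
      refine propext (forall₂_congr fun t ht => ?_)
      rw [hxy t ht]
    have h1 := hX.lintegral_prod (Finset.Icc (j - M) (j + M))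
      (fun t y => if good (y t) then 1 else 0) (fun t => {t}) (fun t _ => (hd t).ite _ _)
      (fun s _ t _ hst => by simpa using hst)
    have h2 : ∀ ω, (∏ t ∈ Finset.Icc (j - M) (j + M), if good (X ω t) then (1 : ℝ≥0∞) else 0) =
        if B (X ω) then 1 else 0 := by
      intro ω
      exact Finset.prod_boole
    rw [lintegral_congr h2, hX.lintegral_ite hBd] at h1
    rw [h1]
    calc p₀ ^ (2 * M + 1) = ∏ t ∈ Finset.Icc (j - M) (j + M), p₀ := by
          rw [Finset.prod_const, Nat.card_Icc]
          congr 1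
          omega
      _ ≤ _ := Finset.prod_le_prod' fun t _ => by
          rw [hX.lintegral_ite (hd t)]
          exact hp t
  have hAd : DependsOn A ((Finset.range (j - M) : Finset ℕ) : Set ℕ) := by
    intro x y hxy
    refine propext (forall₂_congr fun s hs => ?_)
    rw [Finset.sum_congr rfl fun t ht => congrArg step (hxy t ?_)]
    have := (Finset.mem_Ico.1 ht).2
    simpa using this
  have hBd : DependsOn B ((Finset.Icc (j - M) (j + M) : Finset ℕ) : Set ℕ) := by
    intro x y hxy
    refine propext (forall₂_congr fun t ht => ?_)
    rw [hxy t ht]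
  have hDd : DependsOn D ((Finset.Ioc (j + M) (j + K) : Finset ℕ) : Set ℕ) := by
    intro x y hxy
    refine propext (forall₂_congr fun r hr => ?_)
    rw [Finset.sum_congr rfl fun t ht => congrArg step (hxy t ?_)]
    rw [Finset.mem_Ioc] at ht
    simp only [Finset.coe_Ioc, Set.mem_Ioc]
    omega
  -- The three events use disjoint ranges of coordinates: before, inside and after the block of good
  -- steps.
  have h1 : μ {ω | A (X ω) ∧ B (X ω) ∧ D (X ω)} =
      μ {ω | A (X ω)} * (μ {ω | B (X ω)} * μ {ω | D (X ω)}) := by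
    rw [← hX.measure_and (Finset.disjoint_left.2 fun t h1 h2 => ?_) hBd hDd]
    · refine hX.measure_and (T := Finset.Icc (j - M) (j + M) ∪ Finset.Ioc (j + M) (j + K))
        (Finset.disjoint_left.2 fun t h1 h2 => ?_) hAd
        (by rw [Finset.coe_union]; exact hBd.map₂ hDd And)
      simp only [Finset.mem_range, Finset.mem_union, Finset.mem_Icc, Finset.mem_Ioc] at h1 h2
      omega
    · rw [Finset.mem_Icc] at h1
      rw [Finset.mem_Ioc] at h2
      omega
  calc _ ≤ μ {ω | A (X ω)} * (μ {ω | B (X ω)} * μ {ω | D (X ω)}) := by gcongr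
    _ = μ {ω | A (X ω) ∧ B (X ω) ∧ D (X ω)} := h1.symm
    _ ≤ _ := measure_mono fun ω hω => .of_pattern hgood (hMK.trans hKj) hω.2.1 hω.1 hω.2.2

open Classical in
/-- The number of times whose future has a deep fall beyond distance `K`. -/
theorem IndepCoords.measure_card_exists_sum_neg_le (hX : IndepCoords μ X)
    (hφ : ∀ t, ∫⁻ ω, tilt step l δ (X ω t) ∂μ ≤ ρ) (hC : 1 + C * ρ ≤ C) (hρ : ρ ≤ 1)
    (hl : 0 ≤ l) (hδ : 0 ≤ δ) {q η : ℝ≥0∞} {K : ℕ} (hq1 : 1 ≤ q) (hη : η ≠ ∞)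
    (hq : ∀ u, ENNReal.ofReal (Real.exp (l * (δ * K))) ≤ u →
      q * (1 + η + η * u * ρ) ≤ (1 + η) * (1 + η * u)) (a n k : ℕ) :
    q ^ k * μ {ω | k ≤ ((Finset.Ico a (a + n)).filter fun j =>
      ∃ r, j + K < r ∧ ∑ t ∈ Finset.Ioc j r, step (X ω t) < 0).card} ≤
      (1 + η) ^ n * (1 + η * C) := by
  -- Reflection needs a finite horizon `T`. The bound obtained does not depend on it, and continuity
  -- from below removes it.
  set R : ℕ → Ω → Finset ℕ := fun T ω => (Finset.Ico a (a + n)).filter fun j =>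
      ∃ r, r ≤ T ∧ j + K < r ∧ ∑ t ∈ Finset.Ioc j r, step (X ω t) < 0 with hR
  have hmono : ∀ ω, Monotone fun T => R T ω := by
    intro ω T T' hT
    refine Finset.monotone_filter_right _ fun j _ => ?_
    rintro ⟨r, hr, h⟩
    exact ⟨r, hr.trans hT, h⟩
  have hbound : ∀ T, q ^ k * μ {ω | k ≤ (R (a + n + T) ω).card} ≤ (1 + η) ^ n * (1 + η * C) := by
    intro T
    refine le_trans ?_ (hX.measure_card_le_maxProd_le hφ (reflect_injective (a + n + T)) hC hρ
      hq1 hη hq (T + 1) n k)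
    refine mul_le_mul_right (measure_mono fun ω hk => ?_) _
    refine le_trans hk (Finset.card_le_card_of_injOn (fun j => a + n + T - j) ?_ ?_)
    · intro j hj
      simp only [hR, Finset.coe_filter, Finset.mem_Ico, Set.mem_ofPred_eq] at hj ⊢
      obtain ⟨hj, r, hrT, hr, hs⟩ := hj
      exact ⟨by omega, le_maxProd_reflect_of_sum_neg hl hδ hr hrT hs⟩
    · intro j hj j' hj' h
      simp only [hR, Finset.coe_filter, Finset.mem_Ico, Set.mem_ofPred_eq] at hj hj' h
      omega
  have hsub : {ω | k ≤ ((Finset.Ico a (a + n)).filter fun j =>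
      ∃ r, j + K < r ∧ ∑ t ∈ Finset.Ioc j r, step (X ω t) < 0).card} ⊆
      ⋃ T, {ω | k ≤ (R (a + n + T) ω).card} := by
    intro ω hω
    have : ∀ j ∈ (Finset.Ico a (a + n)).filter fun j =>
      ∃ r, j + K < r ∧ ∑ t ∈ Finset.Ioc j r, step (X ω t) < 0, ∃ r, j + K < r ∧
        ∑ t ∈ Finset.Ioc j r, step (X ω t) < 0 := fun j hj => (Finset.mem_filter.1 hj).2
    choose! r hr using this
    rw [Set.mem_iUnion]
    refine ⟨(Finset.Ico a (a + n)).sup r, le_trans hω (Finset.card_le_card fun j hj => ?_)⟩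
    refine Finset.mem_filter.2 ⟨(Finset.mem_filter.1 hj).1, r j, ?_, hr j hj⟩
    exact (Finset.le_sup (Finset.mem_filter.1 hj).1).trans (Nat.le_add_left _ _)
  have hmon : Monotone fun T => {ω | k ≤ (R (a + n + T) ω).card} := fun T T' hT ω hω =>
    le_trans hω (Finset.card_le_card (hmono ω (by omega)))
  refine (mul_le_mul_right (measure_mono hsub) _).trans ?_
  rw [hmon.measure_iUnion, ENNReal.mul_iSup]
  exact iSup_le hbound

/-- The probability that a window contains no cut. -/
theorem IndepCoords.measure_no_cut_le (hX : IndepCoords μ X)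
    (hφ : ∀ t, ∫⁻ ω, tilt step l δ (X ω t) ∂μ ≤ ρ) (hC : 1 + C * ρ ≤ C) (hρ : ρ ≤ 1)
    (hp : ∀ t, p₀ ≤ μ {ω | good (X ω t)}) (hgood : ∀ a, good a → step a = 1) (hl : 0 ≤ l)
    (hδ : 0 ≤ δ) {M K : ℕ} (hMK : M ≤ K)
    (hM : C ≤ ENNReal.ofReal (Real.exp (l * M)) * 2⁻¹)
    {q η : ℝ≥0∞} (hq1 : 1 ≤ q) (hqt : q ≠ ∞) (hη : η ≠ ∞)
    (hq : ∀ u, ENNReal.ofReal (Real.exp (l * (δ * K))) ≤ u →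
      q * (1 + η + η * u * ρ) ≤ (1 + η) * (1 + η * u)) (a N k : ℕ) :
    μ {ω | ∀ j ∈ Finset.Ico a (a + N * (2 * K + 1)), ∃ R, ¬ IsLocalCut step good R (X ω) j} ≤
      2 ^ (2 * k) * (1 - 2⁻¹ * (p₀ ^ (2 * M + 1) * 2⁻¹) / 2) ^ N +
      2 * (q⁻¹ ^ k * ((1 + η) ^ (N * (2 * K + 1)) * (1 + η * C))) := by
  classical
  set n := N * (2 * K + 1) with hn
  -- Centres of consecutive blocks of length `2 * K + 1`, so that the local cuts at different
  -- centres are independent.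
  let c : ℕ → ℕ := fun i => a + i * (2 * K + 1) + K
  have hcn : ∀ i < N, a ≤ c i ∧ c i < a + n := by
    intro i hi
    have : (i + 1) * (2 * K + 1) ≤ n := Nat.mul_le_mul_right _ hi
    have h2 : (i + 1) * (2 * K + 1) = i * (2 * K + 1) + (2 * K + 1) := by ring
    simp only [c]
    omega
  have hcc : ∀ i i', i < i' → c i + (2 * K + 1) ≤ c i' := by
    intro i i' h
    have : (i + 1) * (2 * K + 1) ≤ i' * (2 * K + 1) := Nat.mul_le_mul_right _ h
    have h2 : (i + 1) * (2 * K + 1) = i * (2 * K + 1) + (2 * K + 1) := by ring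
    simp only [c]
    omega
  have hci : c.Injective := fun i i' h => by
    rcases lt_trichotomy i i' with h' | h' | h'
    · have := hcc _ _ h'; omega
    · exact h'
    · have := hcc _ _ h'; omega
  set LC : Set Ω := {ω | ((Finset.range N).filter fun i =>
    IsLocalCut step good K (X ω) (c i)).card < 2 * k}
  set LB : Set Ω := {ω | k ≤ ((Finset.Ico a (a + n)).filter fun s =>
    ENNReal.ofReal (Real.exp (l * (δ * K))) ≤ maxProd (tilt step l δ) (X ω ∘ id) s).card}
  set RB : Set Ω := {ω | k ≤ ((Finset.Ico a (a + n)).filter fun j =>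
      ∃ r, j + K < r ∧ ∑ t ∈ Finset.Ioc j r, step (X ω t) < 0).card}
  have hLC : μ LC ≤ 2 ^ (2 * k) * (1 - 2⁻¹ * (p₀ ^ (2 * M + 1) * 2⁻¹) / 2) ^ N := by
    refine hX.measure_card_lt_le N (2 * k) (fun i y => IsLocalCut step good K y (c i)) _
      (fun i => dependsOn_isLocalCut step good) ?_ fun i _ =>
      hX.le_measure_isLocalCut hφ hC hp hgood hl hδ hMK (by simp only [c]; omega) hM
    intro i _ i' _ h
    refine Finset.disjoint_left.2 fun t h1 h2 => ?_
    rw [Finset.mem_Icc] at h1 h2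
    rcases lt_or_gt_of_ne h with h' | h'
    · have := hcc _ _ h'; omega
    · have := hcc _ _ h'; omega
  have hdiv : ∀ {x y : ℝ≥0∞}, q ^ k * x ≤ y → x ≤ q⁻¹ ^ k * y := by
    intro x y h
    have hq0 : q ≠ 0 := (zero_lt_one.trans_le hq1).ne'
    calc x = q⁻¹ ^ k * (q ^ k * x) := by
          rw [← mul_assoc, ← mul_pow, ENNReal.inv_mul_cancel hq0 hqt, one_pow, one_mul]
      _ ≤ _ := by gcongr
  have hLB := hdiv (hX.measure_card_le_maxProd_le hφ Function.injective_id hC hρ hq1 hη hq a n k)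
  have hRB := hdiv (hX.measure_card_exists_sum_neg_le hφ hC hρ hl hδ hq1 hη hq a n k)
  -- Without a cut in the window, every local cut at a centre is spoiled by a violation beyond
  -- distance `K`, to the left or to the right. Hence `2 * k` local cuts force `k` violations on one
  -- of the sides.
  have hsub : {ω | ∀ j ∈ Finset.Ico a (a + n), ∃ R, ¬ IsLocalCut step good R (X ω) j} ⊆
      LC ∪ (LB ∪ RB) := by
    intro ω hω
    by_contra hnot
    simp only [Set.mem_union, LC, LB, RB, Set.mem_ofPred_eq, not_or, not_le, not_lt,
      Function.comp_id] at hnot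
    obtain ⟨h1, h2, h3⟩ := hnot
    have hsubset : ((Finset.range N).filter fun i =>
        IsLocalCut step good K (X ω) (c i)).image c ⊆
        ((Finset.Ico a (a + n)).filter fun s =>
          ENNReal.ofReal (Real.exp (l * (δ * K))) ≤ maxProd (tilt step l δ) (X ω) s) ∪
        ((Finset.Ico a (a + n)).filter fun j =>
          ∃ r, j + K < r ∧ ∑ t ∈ Finset.Ioc j r, step (X ω t) < 0) := by
      intro j hj
      obtain ⟨i, hi, rfl⟩ := Finset.mem_image.1 hj
      rw [Finset.mem_filter, Finset.mem_range] at hi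
      have hIco : c i ∈ Finset.Ico a (a + n) := Finset.mem_Ico.2 (hcn i hi.1)
      obtain ⟨R, hnc⟩ := hω _ hIco
      rw [Finset.mem_union, Finset.mem_filter, Finset.mem_filter]
      by_contra hcon
      simp only [hIco, true_and, not_or, not_exists, not_and, not_lt] at hcon
      refine hnc ⟨hi.2.good, fun s hs _ => ?_, fun r _ => ?_⟩
      · rcases le_or_gt (c i) (s + K) with h | h
        · exact hi.2.left s hs h
        · by_contra hle
          exact hcon.1 (le_maxProd_of_sum_nonpos hl hδ h (by omega))
      · rcases le_or_gt r (c i + K) with h | h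
        · exact hi.2.right r h
        · exact hcon.2 r h
    have h4 := (Finset.card_le_card hsubset).trans (Finset.card_union_le _ _)
    rw [Finset.card_image_of_injective _ hci] at h4
    omega
  calc _ ≤ μ (LC ∪ (LB ∪ RB)) := measure_mono hsub
    _ ≤ μ LC + (μ LB + μ RB) := (measure_union_le _ _).trans (by gcongr; exact measure_union_le _ _)
    _ ≤ _ := by
      refine add_le_add hLC ?_
      rw [two_mul]
      exact add_le_add hLB hRB

end WalkCut

/-! ### Choice of the constants -/

section Constants

open scoped NNReal in
-- Since `q * ρ ≤ (1 + ρ) / 2`, the right side gains at least `(1 - ρ) / 2 * (η * u) ≥ 4` in the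
-- terms with `u`, while `q * (1 + η) ≤ 4`.
theorem mul_one_add_le_of_le {q η ρ b : ℝ≥0} (hη : 0 < η) (hη1 : η ≤ 1)
    (hq : q ≤ 2) (hqρ : 2 * (q * ρ) ≤ 1 + ρ) (hb : 8 ≤ (1 - (ρ : ℝ)) * (η * b)) (hρ : ρ ≤ 1) (u : ℝ≥0∞)
    (hu : (b : ℝ≥0∞) ≤ u) : (q : ℝ≥0∞) * (1 + η + η * u * ρ) ≤ (1 + η) * (1 + η * u) := by
  induction u with
  | top =>
    rw [ENNReal.mul_top (by simpa using hη.ne')]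
    simp
  | coe u =>
    norm_cast at hu ⊢
    rw [← NNReal.coe_le_coe]
    have h1 : (b : ℝ) ≤ u := hu
    have h2 : (η : ℝ) ≤ 1 := hη1
    have h3 : (q : ℝ) ≤ 2 := hq
    have h4 : 2 * ((q : ℝ) * ρ) ≤ 1 + ρ := hqρ
    have h5 : (ρ : ℝ) ≤ 1 := hρ
    have h6 : (0 : ℝ) < η := hη
    have h7 : (0 : ℝ) ≤ q := q.2
    have h8 : (0 : ℝ) ≤ η * u := by positivity
    push_cast
    have h9 : (1 - (ρ : ℝ)) * (η * b) ≤ (1 - ρ) * (η * u) := by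
      have : (0 : ℝ) ≤ 1 - ρ := by linarith
      gcongr
    have h10 : (q : ℝ) * (1 + η) ≤ 4 := by nlinarith
    have h11 : 2 * ((q : ℝ) * ρ) * (η * u) ≤ (1 + ρ) * (η * u) := by gcongr
    nlinarith

/-- The exponential decay of `x ^ K` beats the block length, which is linear in `K`. -/
theorem exists_range_const {x R s : ℝ} (hx0 : 0 < x) (hx : x < 1) (hR : 0 < R) (hs : 1 < s)
    (w M : ℕ) : ∃ K, M ≤ K ∧ R * x ^ K ≤ 1 ∧ (1 + R * x ^ K) ^ (w * (2 * K + 1)) ≤ s := by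
  have habs : |x| < 1 := by rwa [abs_of_pos hx0]
  have h0 : Filter.Tendsto (fun K : ℕ => x ^ K) Filter.atTop (nhds 0) :=
    tendsto_pow_atTop_nhds_zero_of_lt_one hx0.le hx
  have h1 : Filter.Tendsto (fun K : ℕ => (K : ℝ) ^ 1 * x ^ K) Filter.atTop (nhds 0) :=
    tendsto_pow_const_mul_const_pow_of_abs_lt_one 1 habs
  have h2 : Filter.Tendsto (fun K : ℕ => R * x ^ K) Filter.atTop (nhds 0) := by
    simpa using h0.const_mul R
  have h3 : Filter.Tendsto (fun K : ℕ => R * x ^ K * (w * (2 * K + 1))) Filter.atTop (nhds 0) := by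
    have := (h1.const_mul (2 * w * R)).add (h0.const_mul (w * R))
    simp only [mul_zero, add_zero] at this
    refine this.congr fun K => ?_
    ring
  have hlog : 0 < Real.log s := Real.log_pos hs
  obtain ⟨K, hK1, hK2, hK3⟩ := ((h2.eventually_le_const one_pos).and
    ((h3.eventually_le_const hlog).and (Filter.eventually_ge_atTop M))).exists
  refine ⟨K, hK3, hK1, ?_⟩
  calc (1 + R * x ^ K) ^ (w * (2 * K + 1)) ≤ (Real.exp (R * x ^ K)) ^ (w * (2 * K + 1)) := by
        gcongr
        rw [add_comm]
        exact Real.add_one_le_exp _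
    _ = Real.exp (R * x ^ K * (w * (2 * K + 1))) := by
        rw [← Real.exp_nat_mul]
        push_cast
        ring_nf
    _ ≤ Real.exp (Real.log s) := Real.exp_le_exp.2 hK2
    _ = s := Real.exp_log (one_pos.trans hs)

/-- Windows without a cut are exponentially rare in their length. -/
theorem exists_measure_no_cut_le {α : Type*} {step : α → ℤ} {good : α → Prop}
    (hgood : ∀ a, good a → step a = 1) {l δ ρ g : ℝ} (hl : 0 < l) (hδ : 0 < δ) (hρ : 1 / 2 ≤ ρ)
    (hρ1 : ρ < 1) (hg : 0 < g) (hg1 : g ≤ 1) :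
    ∃ L : ℕ, 0 < L ∧ ∃ A r : ℝ, 0 < A ∧ 0 < r ∧ r < 1 ∧
      ∀ (Ω : Type*) [MeasurableSpace Ω] (μ : Measure Ω) [IsProbabilityMeasure μ]
        (X : Ω → ℕ → α), IndepCoords μ X →
        (∀ t, ∫⁻ ω, tilt step l δ (X ω t) ∂μ ≤ ENNReal.ofReal ρ) →
        (∀ t, ENNReal.ofReal g ≤ μ {ω | good (X ω t)}) →
        ∀ a k : ℕ, μ {ω | ∀ j ∈ Finset.Ico a (a + k * L), ∃ R, ¬ IsLocalCut step good R (X ω) j} ≤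
          ENNReal.ofReal (A * r ^ k) := by
  have h1ρ : 0 < 1 - ρ := by linarith
  set C : ℝ := 1 / (1 - ρ) with hC
  have hCpos : 0 < C := by positivity
  have hC1 : C * (1 - ρ) = 1 := by rw [hC]; field_simp
  obtain ⟨M, hM⟩ : ∃ M : ℕ, 2 * C / l ≤ M := exists_nat_ge _
  have hM' : C ≤ Real.exp (l * M) * 2⁻¹ := by
    have h1 := Real.add_one_le_exp (l * M)
    rw [div_le_iff₀ hl] at hM
    linarith
  set p : ℝ := 2⁻¹ * (g ^ (2 * M + 1) * 2⁻¹) / 2 with hp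
  have hp0 : 0 < p := by positivity
  have hp1 : p < 1 := by
    have := pow_le_one₀ (n := 2 * M + 1) hg.le hg1
    rw [hp]
    linarith
  -- With `k * w` blocks the factor `4 ^ k` of the Chernoff bound is absorbed, leaving at most `2⁻¹
  -- ^ k`. Neither `M`, `p` nor `w` depends on `K`, which is chosen later.
  obtain ⟨w, hw⟩ := exists_pow_lt_of_lt_one (show (0 : ℝ) < 1 / 8 by norm_num)
    (show 1 - p < 1 by linarith)
  have hw0 : 0 < w := by
    rcases Nat.eq_zero_or_pos w with rfl | h
    · norm_num at hw
    · exact h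
  -- Then `q * ρ` is the midpoint of `ρ` and `1`, and `ρ ≥ 1 / 2` keeps `q ≤ 2`.
  set q : ℝ := (1 + ρ) / (2 * ρ) with hq
  have hρ0 : 0 < ρ := by linarith
  have hqρ : 2 * (q * ρ) = 1 + ρ := by rw [hq]; field_simp
  have hq1 : 1 < q := by
    rw [hq, lt_div_iff₀ (by linarith)]
    linarith
  have hq2 : q ≤ 2 := by nlinarith
  have hx1 : Real.exp (-(l * δ)) < 1 := by
    rw [Real.exp_lt_one_iff]
    have : 0 < l * δ := by positivity
    linarith
  obtain ⟨K, hMK, hK1, hK2⟩ := exists_range_const (Real.exp_pos _) hx1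
    (show 0 < 8 / (1 - ρ) by positivity) (show 1 < (1 + q) / 2 by linarith) w M
  -- The value for which `(1 - ρ) * η * exp (l * (δ * K))` is exactly `8`. The choice of `K` keeps
  -- the growth of `1 + η` over `w` blocks below `(1 + q) / 2 < q`.
  set η : ℝ := 8 / (1 - ρ) * Real.exp (-(l * δ)) ^ K with hη
  have hη0 : 0 < η := by positivity
  set r : ℝ := (1 + q) / 2 / q with hr
  have hr0 : 0 < r := by positivity
  have hr1 : r < 1 := by
    rw [hr, div_lt_one (by linarith)]
    linarith
  refine ⟨w * (2 * K + 1), by positivity, 1 + 2 * (1 + C), max (1 / 2) r, by positivity,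
    by positivity, max_lt (by norm_num) hr1, ?_⟩
  intro Ω _ μ _ X hX hφ hpg a k
  have hCE : 1 + ENNReal.ofReal C * ENNReal.ofReal ρ ≤ ENNReal.ofReal C := by
    rw [← ENNReal.ofReal_mul hCpos.le, ← ENNReal.ofReal_one, ← ENNReal.ofReal_add (by norm_num)
      (by positivity)]
    refine ENNReal.ofReal_le_ofReal ?_
    linarith
  have hME : ENNReal.ofReal C ≤ ENNReal.ofReal (Real.exp (l * M)) * 2⁻¹ := by
    rw [← ENNReal.ofReal_ofNat, ← ENNReal.ofReal_inv_of_pos (by norm_num),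
      ← ENNReal.ofReal_mul (Real.exp_pos _).le]
    exact ENNReal.ofReal_le_ofReal hM'
  have hqE : ∀ u, ENNReal.ofReal (Real.exp (l * (δ * K))) ≤ u →
      ENNReal.ofReal q * (1 + ENNReal.ofReal η + ENNReal.ofReal η * u * ENNReal.ofReal ρ) ≤
      (1 + ENNReal.ofReal η) * (1 + ENNReal.ofReal η * u) := by
    intro u hu
    refine mul_one_add_le_of_le (b := (Real.exp (l * (δ * K))).toNNReal) ?_ ?_ ?_ ?_ ?_ ?_ u hu
    · exact Real.toNNReal_pos.2 hη0
    · exact Real.toNNReal_le_one.2 hK1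
    · rw [Real.toNNReal_le_iff_le_coe]
      exact hq2
    · rw [← NNReal.coe_le_coe]
      push_cast
      rw [Real.coe_toNNReal _ hρ0.le, Real.coe_toNNReal _ (by linarith)]
      exact hqρ.le
    · rw [Real.coe_toNNReal _ hρ0.le, Real.coe_toNNReal _ hη0.le,
        Real.coe_toNNReal _ (Real.exp_pos _).le]
      have h1 : Real.exp (-(l * δ)) ^ K * Real.exp (l * (δ * K)) = 1 := by
        rw [← Real.exp_nat_mul, ← Real.exp_add]
        simp only [Real.exp_eq_one_iff]
        ring
      calc (8 : ℝ) = (1 - ρ) * (8 / (1 - ρ) * (Real.exp (-(l * δ)) ^ K * Real.exp (l * (δ * K)))) := by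
            rw [h1]
            field_simp
        _ ≤ _ := by
            rw [hη]
            apply le_of_eq
            ring
    · exact Real.toNNReal_le_one.2 hρ1.le
  have hmain := hX.measure_no_cut_le hφ hCE (by rw [ENNReal.ofReal_le_one]; exact hρ1.le) hpg hgood
    hl.le hδ.le hMK hME (by rw [ENNReal.one_le_ofReal]; exact hq1.le) ENNReal.ofReal_ne_top
    ENNReal.ofReal_ne_top hqE a (k * w) k
  rw [show k * (w * (2 * K + 1)) = k * w * (2 * K + 1) by ring]
  refine hmain.trans ?_
  have e1 : (1 : ℝ≥0∞) - 2⁻¹ * (ENNReal.ofReal g ^ (2 * M + 1) * 2⁻¹) / 2 = ENNReal.ofReal (1 - p) := by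
    rw [ENNReal.ofReal_sub _ hp0.le, ENNReal.ofReal_one, hp, ENNReal.ofReal_div_of_pos (by norm_num),
      ENNReal.ofReal_mul (by norm_num), ENNReal.ofReal_mul (by positivity),
      ENNReal.ofReal_pow hg.le, ENNReal.ofReal_inv_of_pos (by norm_num), ENNReal.ofReal_ofNat]
  have e2 : (1 : ℝ≥0∞) + ENNReal.ofReal η = ENNReal.ofReal (1 + η) := by
    rw [ENNReal.ofReal_add (by norm_num) hη0.le, ENNReal.ofReal_one]
  have e3 : (1 : ℝ≥0∞) + ENNReal.ofReal η * ENNReal.ofReal C = ENNReal.ofReal (1 + η * C) := by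
    rw [ENNReal.ofReal_add (by norm_num) (by positivity), ENNReal.ofReal_one,
      ENNReal.ofReal_mul hη0.le]
  rw [e1, e2, e3, ← ENNReal.ofReal_inv_of_pos (by linarith),
    ← ENNReal.ofReal_pow (by positivity),
    ← ENNReal.ofReal_pow (by positivity),
    ← ENNReal.ofReal_pow (by positivity), ← ENNReal.ofReal_mul (by positivity), ← ENNReal.ofReal_mul (by positivity),
    ← ENNReal.ofReal_ofNat, ← ENNReal.ofReal_mul (by positivity),
    ← ENNReal.ofReal_pow (by positivity), ← ENNReal.ofReal_mul (by positivity),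
    ← ENNReal.ofReal_add (mul_nonneg (by positivity) (pow_nonneg (by linarith) _)) (by positivity)]
  refine ENNReal.ofReal_le_ofReal ?_
  have f1 : (2 : ℝ) ^ (2 * k) * (1 - p) ^ (k * w) ≤ (max (1 / 2) r) ^ k := by
    rw [pow_mul, mul_comm k w, pow_mul, ← mul_pow]
    refine pow_le_pow_left₀ (mul_nonneg (by norm_num) (pow_nonneg (by linarith) _)) ?_ k
    exact le_max_of_le_left (by linarith)
  have f2 : q⁻¹ ^ k * (1 + η) ^ (k * w * (2 * K + 1)) ≤ (max (1 / 2) r) ^ k := by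
    rw [show k * w * (2 * K + 1) = w * (2 * K + 1) * k by ring, pow_mul, ← mul_pow]
    refine pow_le_pow_left₀ (by positivity) ?_ k
    refine le_max_of_le_right ?_
    rw [hr, div_eq_mul_inv, mul_comm]
    gcongr
  have f3 : η * C ≤ C := mul_le_of_le_one_left hCpos.le hK1
  have f4 : (0 : ℝ) < max (1 / 2) r ^ k := by positivity
  calc _ = (2 : ℝ) ^ (2 * k) * (1 - p) ^ (k * w) +
        2 * (q⁻¹ ^ k * (1 + η) ^ (k * w * (2 * K + 1)) * (1 + η * C)) := by ring
    _ ≤ max (1 / 2) r ^ k + 2 * (max (1 / 2) r ^ k * (1 + C)) := by gcongr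
    _ = _ := by ring

end Constants

/-! ### Poisson elections and the walk of leads -/

section Election

/-- The numbers of honest and adversarial leaders of all epochs. -/
def leaders {Ω : Type*} (H Z : ℕ → Ω → ℕ) (ω : Ω) (t : ℕ) : ℕ × ℕ := (H t ω, Z t ω)

/-- Finitely many epochs involve finitely many natural numbers, a countable space on which every
function is measurable; independence thus passes to arbitrary `f`. -/
theorem exists_comp_leaders {Ω : Type*} {S : Finset ℕ} {f : (ℕ → ℕ × ℕ) → ℝ≥0∞}
    (hf : DependsOn f (S : Set ℕ)) :
    ∃ F : (S.disjSum S → ℕ) → ℝ≥0∞,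
      ∀ (H Z : ℕ → Ω → ℕ) (ω : Ω), f (leaders H Z ω) = F fun i => Sum.elim H Z i ω := by
  classical
  refine ⟨fun y => f fun t => if ht : t ∈ S then
    (y ⟨Sum.inl t, by simpa using ht⟩, y ⟨Sum.inr t, by simpa using ht⟩) else 0, ?_⟩
  intro H Z ω
  refine hf fun t ht => ?_
  rw [Finset.mem_coe] at ht
  simp [ht, leaders]

variable {Ω : Type*} [MeasurableSpace Ω] {μ : Measure Ω} {m β : ℝ} {H Z : ℕ → Ω → ℕ}

/-- The guaranteed growth of honest chains minus the number of adversarial leaders. -/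
def lead (a : ℕ × ℕ) : ℤ := (min a.1 1 : ℕ) - (a.2 : ℤ)

theorem LeaderElection.aemeasurable (hE : LeaderElection μ m β H Z) (i : ℕ ⊕ ℕ) :
    AEMeasurable (Sum.elim H Z i) μ := by
  cases i with
  | inl t => exact (hE.law_honest t).aemeasurable
  | inr t => exact (hE.law_adversarial t).aemeasurable

theorem LeaderElection.indepCoords (hE : LeaderElection μ m β H Z) :
    IndepCoords μ (leaders H Z) := by
  have htup : ∀ S : Finset (ℕ ⊕ ℕ), AEMeasurable (fun ω (i : S) => Sum.elim H Z i ω) μ :=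
    fun S => aemeasurable_pi_lambda _ fun i => hE.aemeasurable i
  constructor
  · intro S f hf
    obtain ⟨F, hF⟩ := exists_comp_leaders (Ω := Ω) hf
    simp_rw [hF]
    exact (measurable_of_countable F).comp_aemeasurable (htup _)
  · intro S T f g hST hf hg
    obtain ⟨F, hF⟩ := exists_comp_leaders (Ω := Ω) hf
    obtain ⟨G, hG⟩ := exists_comp_leaders (Ω := Ω) hg
    simp_rw [hF, hG]
    refine lintegral_mul_eq_lintegral_mul_lintegral_of_indepFun''
      ((measurable_of_countable F).comp_aemeasurable (htup _))
      ((measurable_of_countable G).comp_aemeasurable (htup _)) ?_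
    refine (hE.indep.indepFun_finset₀ (S.disjSum S) (T.disjSum T) ?_ hE.aemeasurable).comp
      (measurable_of_countable F) (measurable_of_countable G)
    refine Finset.disjoint_left.2 fun i h1 h2 => ?_
    cases i with
    | inl t =>
      simp only [Finset.inl_mem_disjSum] at h1 h2
      exact Finset.disjoint_left.1 hST h1 h2
    | inr t =>
      simp only [Finset.inr_mem_disjSum] at h1 h2
      exact Finset.disjoint_left.1 hST h1 h2

theorem lintegral_exp_poissonMeasure (b : NNReal) (l : ℝ) :
    ∫⁻ k, ENNReal.ofReal (Real.exp (l * k)) ∂(poissonMeasure b) =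
      ENNReal.ofReal (Real.exp (b * (Real.exp l - 1))) := by
  rw [lintegral_countable']
  have hs : HasSum (fun k : ℕ => Real.exp (-b) * ((b * Real.exp l) ^ k / k.factorial))
      (Real.exp (-b) * Real.exp (b * Real.exp l)) := by
    refine HasSum.mul_left _ ?_
    rw [Real.exp_eq_exp_ℝ]
    exact NormedSpace.expSeries_div_hasSum_exp _
  have hterm : ∀ k : ℕ, ENNReal.ofReal (Real.exp (l * k)) * poissonMeasure b {k} =
      ENNReal.ofReal (Real.exp (-b) * ((b * Real.exp l) ^ k / k.factorial)) := by
    intro k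
    rw [poissonMeasure_singleton, ← ENNReal.ofReal_mul (Real.exp_pos _).le, mul_pow,
      ← Real.exp_nat_mul, mul_comm l]
    congr 1
    ring
  simp_rw [hterm]
  rw [← ENNReal.ofReal_tsum_of_nonneg (fun k => by positivity) hs.summable, hs.tsum_eq,
    ← Real.exp_add]
  congr 2
  ring

theorem lintegral_exp_min_poissonMeasure (a : NNReal) {l : ℝ} (hl : 0 ≤ l) :
    ∫⁻ k, ENNReal.ofReal (Real.exp (-(l * (min k 1 : ℕ)))) ∂(poissonMeasure a) =
      ENNReal.ofReal (1 - (1 - Real.exp (-l)) * (1 - Real.exp (-a))) := by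
  have h1 : 0 ≤ 1 - Real.exp (-l) := by
    rw [sub_nonneg, Real.exp_le_one_iff]
    linarith
  have hk : ∀ k : ℕ, ENNReal.ofReal (Real.exp (-(l * (min k 1 : ℕ)))) =
      ENNReal.ofReal (Real.exp (-l)) +
        ENNReal.ofReal (1 - Real.exp (-l)) * ({0} : Set ℕ).indicator 1 k := by
    intro k
    rcases Nat.eq_zero_or_pos k with rfl | h
    · rw [Set.indicator_of_mem (by simp), Pi.one_apply, mul_one,
        ← ENNReal.ofReal_add (Real.exp_pos (-l)).le h1]
      simp
    · simp [h.ne', Nat.min_eq_right h]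
  simp_rw [hk]
  rw [lintegral_add_left measurable_const, lintegral_const_mul' _ _ ENNReal.ofReal_ne_top,
    lintegral_indicator_one (measurableSet_singleton 0), poissonMeasure_singleton]
  simp only [lintegral_const, measure_univ, mul_one, pow_zero, Nat.factorial_zero, Nat.cast_one,
    div_one]
  rw [← ENNReal.ofReal_mul h1, ← ENNReal.ofReal_add (Real.exp_pos _).le
    (mul_nonneg h1 (Real.exp_pos _).le)]
  congr 1
  ring

/-- The mean factors by independence within an epoch; `1 - x ≤ exp (-x)` brings the honest factor
into the exponent. -/
theorem LeaderElection.lintegral_tilt_le (hE : LeaderElection μ m β H Z) {l δ : ℝ} (hl : 0 ≤ l)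
    (hβm : 0 ≤ β * m) (hβm' : 0 ≤ (1 - β) * m) (t : ℕ) :
    ∫⁻ ω, tilt lead l δ (leaders H Z ω t) ∂μ ≤ ENNReal.ofReal (Real.exp (l * δ +
      β * m * (Real.exp l - 1) - (1 - Real.exp (-l)) * (1 - Real.exp (-((1 - β) * m))))) := by
  have hfac : ∀ ω, tilt lead l δ (leaders H Z ω t) = ENNReal.ofReal (Real.exp (l * δ)) *
      (ENNReal.ofReal (Real.exp (-(l * (min (H t ω) 1 : ℕ)))) *
        ENNReal.ofReal (Real.exp (l * Z t ω))) := by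
    intro ω
    rw [← ENNReal.ofReal_mul (Real.exp_pos _).le, ← ENNReal.ofReal_mul (Real.exp_pos _).le,
      ← Real.exp_add, ← Real.exp_add, tilt, lead, leaders]
    congr 2
    push_cast
    ring
  simp_rw [hfac]
  rw [lintegral_const_mul' _ _ ENNReal.ofReal_ne_top,
    lintegral_mul_eq_lintegral_mul_lintegral_of_indepFun''
      (f := fun ω => ENNReal.ofReal (Real.exp (-(l * (min (H t ω) 1 : ℕ)))))
      (g := fun ω => ENNReal.ofReal (Real.exp (l * Z t ω)))
      ((measurable_of_countable
        fun k : ℕ => ENNReal.ofReal (Real.exp (-(l * (min k 1 : ℕ))))).comp_aemeasurable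
        (hE.law_honest t).aemeasurable)
      ((measurable_of_countable fun k : ℕ => ENNReal.ofReal (Real.exp (l * k))).comp_aemeasurable
        (hE.law_adversarial t).aemeasurable)
      ((hE.indep.indepFun (i := Sum.inl t) (j := Sum.inr t) (by simp)).comp
        (measurable_of_countable fun k : ℕ => ENNReal.ofReal (Real.exp (-(l * (min k 1 : ℕ)))))
        (measurable_of_countable fun k : ℕ => ENNReal.ofReal (Real.exp (l * k))))]
  have h1 : ∫⁻ ω, ENNReal.ofReal (Real.exp (-(l * (min (H t ω) 1 : ℕ)))) ∂μ =
      ENNReal.ofReal (1 - (1 - Real.exp (-l)) * (1 - Real.exp (-((1 - β) * m)))) := by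
    rw [← lintegral_map' (f := fun k : ℕ => ENNReal.ofReal (Real.exp (-(l * (min k 1 : ℕ)))))
      (measurable_of_countable _).aemeasurable (hE.law_honest t).aemeasurable,
      (hE.law_honest t).map_eq, lintegral_exp_min_poissonMeasure _ hl, Real.coe_toNNReal _ hβm']
  have h2 : ∫⁻ ω, ENNReal.ofReal (Real.exp (l * Z t ω)) ∂μ =
      ENNReal.ofReal (Real.exp (β * m * (Real.exp l - 1))) := by
    rw [← lintegral_map' (f := fun k : ℕ => ENNReal.ofReal (Real.exp (l * k)))
      (measurable_of_countable _).aemeasurable (hE.law_adversarial t).aemeasurable,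
      (hE.law_adversarial t).map_eq, lintegral_exp_poissonMeasure, Real.coe_toNNReal _ hβm]
  rw [h1, h2, ← ENNReal.ofReal_mul' (Real.exp_pos _).le, ← ENNReal.ofReal_mul (Real.exp_pos _).le]
  refine ENNReal.ofReal_le_ofReal ?_
  have h3 := Real.add_one_le_exp (-((1 - Real.exp (-l)) * (1 - Real.exp (-((1 - β) * m)))))
  calc _ ≤ Real.exp (l * δ) * (Real.exp (-((1 - Real.exp (-l)) * (1 - Real.exp (-((1 - β) * m))))) *
        Real.exp (β * m * (Real.exp l - 1))) := by
        gcongr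
        linarith
    _ = _ := by
        rw [← Real.exp_add, ← Real.exp_add]
        congr 1
        ring

theorem LeaderElection.le_measure_loner (hE : LeaderElection μ m β H Z) (hβm : 0 ≤ β * m)
    (hβm' : 0 ≤ (1 - β) * m) (t : ℕ) :
    ENNReal.ofReal (Real.exp (-((1 - β) * m)) * ((1 - β) * m) * Real.exp (-(β * m))) ≤
      μ {ω | leaders H Z ω t = (1, 0)} := by
  have h1 : {ω | leaders H Z ω t = (1, 0)} = H t ⁻¹' {1} ∩ Z t ⁻¹' {0} := by
    ext ω
    simp [leaders]
  have h2 := (hE.indep.indepFun (i := Sum.inl t) (j := Sum.inr t) (by simp)).measure_inter_preimage_eq_mul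
    {1} {0} (measurableSet_singleton _) (measurableSet_singleton _)
  simp only [Sum.elim_inl, Sum.elim_inr] at h2
  rw [h1, h2, ← Measure.map_apply_of_aemeasurable (hE.law_honest t).aemeasurable
    (measurableSet_singleton _), ← Measure.map_apply_of_aemeasurable
    (hE.law_adversarial t).aemeasurable (measurableSet_singleton _), (hE.law_honest t).map_eq,
    (hE.law_adversarial t).map_eq, poissonMeasure_singleton, poissonMeasure_singleton,
    ← ENNReal.ofReal_mul (by positivity), Real.coe_toNNReal _ hβm, Real.coe_toNNReal _ hβm']
  simp

/-- Left part, cut epoch and right part give a total lead of at least `1 + 1 + 0` over `[s, r]`.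
Dropping the honest contribution of epoch `s`, at most one, leaves a strict surplus. -/
theorem isCut_of_isLocalCut {h z : ℕ → ℕ} {j : ℕ} (hj : 0 < j)
    (hcut : ∀ R, IsLocalCut lead (· = (1, 0)) R (fun t => (h t, z t)) j) : IsCut h z j := by
  have hgood := (hcut 0).good
  simp only [Prod.mk.injEq] at hgood
  refine ⟨hj, hgood.1, hgood.2, fun s hs r hr => ?_⟩
  have h1 := (hcut j).left s hs (by omega)
  have h2 := (hcut r).right r (by omega)
  have h3 : ∑ t ∈ Finset.Icc s r, lead (h t, z t) = ∑ t ∈ Finset.Ico s j, lead (h t, z t) +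
      (lead (h j, z j) + ∑ t ∈ Finset.Ioc j r, lead (h t, z t)) := by
    have e1 : Finset.Icc s r = Finset.Ico s j ∪ Finset.Icc j r := by
      ext t
      simp only [Finset.mem_Icc, Finset.mem_union, Finset.mem_Ico]
      omega
    rw [e1, Finset.sum_union, ← Finset.Ioc_insert_left hr, Finset.sum_insert (by simp)]
    refine Finset.disjoint_left.2 fun t h1 h2 => ?_
    rw [Finset.mem_Ico] at h1
    rw [Finset.mem_Icc] at h2
    omega
  have h4 : lead (h j, z j) = 1 := by simp [lead, hgood]
  have h5 : ∑ t ∈ Finset.Icc s r, min (h t) 1 = min (h s) 1 + ∑ t ∈ Finset.Ioc s r, min (h t) 1 := by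
    rw [← Finset.Ioc_insert_left (by omega), Finset.sum_insert (by simp)]
  have h6 : ∑ t ∈ Finset.Icc s r, lead (h t, z t) =
      (∑ t ∈ Finset.Icc s r, min (h t) 1 : ℕ) - ((∑ t ∈ Finset.Icc s r, z t : ℕ) : ℤ) := by
    simp only [lead]
    rw [Finset.sum_sub_distrib]
    push_cast
    rfl
  omega

/-- A suitable exponential tilt exists when honest growth outpaces the adversary. -/
theorem exists_tilt {b p : ℝ} (hb : 0 ≤ b) (hbp : b < p) (hp : p ≤ 1) :
    ∃ l δ : ℝ, 0 < l ∧ 0 < δ ∧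
      Real.exp (l * δ + b * (Real.exp l - 1) - (1 - Real.exp (-l)) * p) < 1 := by
  -- As `p ≤ 1`, `p * (1 - l) ≥ (p + b) / 2 > b`, which yields `b * exp l < p`.
  set l := (p - b) / 2 with hl
  have hl0 : 0 < l := by linarith
  have h1 : 1 - l ≤ Real.exp (-l) := by
    have := Real.add_one_le_exp (-l)
    linarith
  have h2 : b < p * Real.exp (-l) := by nlinarith
  have hee : Real.exp (-l) * Real.exp l = 1 := by rw [← Real.exp_add]; simp
  have h3 : 0 < p - b * Real.exp l := by
    have := mul_lt_mul_of_pos_right h2 (Real.exp_pos l)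
    rw [mul_assoc, hee] at this
    linarith
  have h4 : 0 < 1 - Real.exp (-l) := by
    rw [sub_pos, Real.exp_lt_one_iff]
    linarith
  set D := (1 - Real.exp (-l)) * (p - b * Real.exp l) with hD
  have hD0 : 0 < D := by positivity
  -- Without slack the exponent is `-D`; this `δ` spends half of it.
  refine ⟨l, D / (2 * l), hl0, by positivity, ?_⟩
  rw [Real.exp_lt_one_iff]
  have h5 : l * (D / (2 * l)) = D / 2 := by field_simp
  have h6 : b * (Real.exp l - 1) - (1 - Real.exp (-l)) * p = -D := by
    rw [hD]
    linear_combination b * hee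
  linarith

/-- Windows of epochs without a cut are exponentially rare. -/
theorem exists_measure_no_isCut_le (hm : 0 < m) (hβ0 : 0 ≤ β) (hβ1 : β ≤ 1)
    (hsec : β * m < 1 - Real.exp (-((1 - β) * m))) :
    ∃ L : ℕ, 0 < L ∧ ∃ A r : ℝ, 0 < A ∧ 0 < r ∧ r < 1 ∧
      ∀ (Ω : Type*) [MeasurableSpace Ω] (μ : Measure Ω) [IsProbabilityMeasure μ]
        (H Z : ℕ → Ω → ℕ), LeaderElection μ m β H Z → ∀ a k : ℕ, 0 < a →
        μ {ω | ∀ j ∈ Finset.Ico a (a + k * L), ¬ IsCut (fun t => H t ω) (fun t => Z t ω) j} ≤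
          ENNReal.ofReal (A * r ^ k) := by
  have hb : 0 ≤ β * m := by positivity
  -- With no honest power the security condition would read `β * m < 0`. Positivity makes lone
  -- honest leaders possible.
  have ha : 0 < (1 - β) * m := by
    rcases (mul_nonneg (sub_nonneg.2 hβ1) hm.le).eq_or_lt with h | h
    · rw [← h] at hsec
      simp at hsec
      linarith
    · exact h
  obtain ⟨l, δ, hl, hδ, hlt⟩ := exists_tilt hb hsec (by linarith [Real.exp_pos (-((1 - β) * m))])
  have hg1 : Real.exp (-((1 - β) * m)) * ((1 - β) * m) * Real.exp (-(β * m)) ≤ 1 := by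
    have h1 : (1 - β) * m ≤ Real.exp ((1 - β) * m) := by
      linarith [Real.add_one_le_exp ((1 - β) * m)]
    have h2 : Real.exp (-((1 - β) * m)) * ((1 - β) * m) ≤ 1 := by
      calc _ ≤ Real.exp (-((1 - β) * m)) * Real.exp ((1 - β) * m) := by gcongr
        _ = 1 := by rw [← Real.exp_add]; simp
    exact mul_le_one₀ h2 (Real.exp_pos _).le (Real.exp_le_one_iff.2 (by linarith))
  obtain ⟨L, hL, A, r, hA, hr0, hr1, hmain⟩ := exists_measure_no_cut_le (α := ℕ × ℕ) (step := lead)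
    (good := (· = (1, 0))) (by rintro _ rfl; simp [lead]) hl hδ (le_max_left (1 / 2) _)
    (max_lt (by norm_num) hlt) (show 0 < Real.exp (-((1 - β) * m)) * ((1 - β) * m) *
      Real.exp (-(β * m)) by positivity) hg1
  refine ⟨L, hL, A, r, hA, hr0, hr1, fun Ω _ μ _ H Z hE a k hak => ?_⟩
  refine le_trans (measure_mono ?_)
    (hmain Ω μ (leaders H Z) hE.indepCoords (fun t => (hE.lintegral_tilt_le hl.le hb ha.le t).trans
      (ENNReal.ofReal_le_ofReal (le_max_right _ _))) (hE.le_measure_loner hb ha.le) a k)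
  intro ω hω j hj
  by_contra hcon
  push Not at hcon
  exact hω j hj (isCut_of_isLocalCut (by have := (Finset.mem_Ico.1 hj).1; omega) hcon)

end Election

/-! ### From windows to `κ`, and the theorem -/

/-- The tail bound for windows of `⌊κ⌋` epochs in terms of `κ`. -/
theorem exists_two_mul_pow_le {A r : ℝ} (hA : 0 < A) (hr0 : 0 < r) (hr1 : r < 1) {L : ℕ}
    (hL : 0 < L) {ε : ℝ} (hε0 : 0 < ε) :
    ∃ c : ℝ, 0 < c ∧ ∃ κ₀ : ℝ, 0 ≤ κ₀ ∧ ∀ κ : ℝ, κ₀ ≤ κ →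
      2 * (A * r ^ (⌊κ⌋₊ / L)) ≤ Real.exp (-(c * κ ^ (1 - ε))) := by
  set γ := -Real.log r with hγ
  have hγ0 : 0 < γ := by
    have := Real.log_neg hr0 hr1
    linarith
  have hLr : (0 : ℝ) < L := by exact_mod_cast hL
  -- Half of the decay rate `γ / L`; for `κ ≥ κ₀` the other half absorbs `2 * A` and the rounding
  -- losses. For `κ ≥ 1` the exponent `1 - ε` only weakens the bound.
  refine ⟨γ / (2 * L), by positivity,
    max 1 (2 * L * (Real.log (2 * A) + 2 * γ) / γ), by positivity, ?_⟩
  intro κ hκ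
  have hκ1 : 1 ≤ κ := (le_max_left _ _).trans hκ
  have hκ2 := (le_max_right _ _).trans hκ
  rw [div_le_iff₀ hγ0] at hκ2
  have hk : κ / L - 2 ≤ (⌊κ⌋₊ / L : ℕ) := by
    have h1 : κ < ⌊κ⌋₊ + 1 := Nat.lt_floor_add_one κ
    have h2 : ⌊κ⌋₊ + 1 ≤ (⌊κ⌋₊ / L + 1) * L := by
      rw [mul_comm]
      exact Nat.lt_mul_div_succ ⌊κ⌋₊ hL
    have h3 : ((⌊κ⌋₊ : ℝ) + 1) ≤ ((⌊κ⌋₊ / L : ℕ) + 1) * L := by exact_mod_cast h2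
    have h4 : κ / L ≤ (⌊κ⌋₊ / L : ℕ) + 1 := by
      rw [div_le_iff₀ hLr]
      linarith
    linarith
  have hpow : κ ^ (1 - ε) ≤ κ := by
    calc κ ^ (1 - ε) ≤ κ ^ (1 : ℝ) := Real.rpow_le_rpow_of_exponent_le hκ1 (by linarith)
      _ = κ := Real.rpow_one κ
  have hrk : r ^ (⌊κ⌋₊ / L) = Real.exp (-(γ * (⌊κ⌋₊ / L : ℕ))) := by
    rw [hγ, neg_mul, neg_neg, mul_comm, Real.exp_nat_mul, Real.exp_log hr0]
  have h2A : 2 * A = Real.exp (Real.log (2 * A)) := (Real.exp_log (by positivity)).symm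
  rw [← mul_assoc, hrk, h2A, ← Real.exp_add]
  refine Real.exp_le_exp.2 ?_
  have h5 : γ / (2 * L) * κ ^ (1 - ε) ≤ γ / (2 * L) * κ := by gcongr
  have h6 : γ * (κ / L - 2) ≤ γ * (⌊κ⌋₊ / L : ℕ) := by gcongr
  have h7 : γ * (κ / L) = 2 * (γ / (2 * L) * κ) := by field_simp
  have h8 : Real.log (2 * A) + 2 * γ ≤ γ / (2 * L) * κ := by
    rw [div_mul_eq_mul_div, le_div_iff₀ (by positivity)]
    linarith
  linarith

end ExpectedConsensus

theorem theorem1 (m β : ℝ) (hm : 0 < m) (hβ0 : 0 ≤ β) (hβ1 : β ≤ 1)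
    (hsec : β * m < 1 - Real.exp (-((1 - β) * m)))
    (ε : ℝ) (hε0 : 0 < ε) (hε1 : ε < 1) :
    ∃ c : ℝ, 0 < c ∧ ∃ κ₀ : ℝ, ∀ κ : ℝ, κ₀ ≤ κ →
      ∀ (Ω : Type*) [MeasurableSpace Ω] (μ : MeasureTheory.Measure Ω)
        [MeasureTheory.IsProbabilityMeasure μ]
        (H Z : ℕ → Ω → ℕ), ExpectedConsensus.LeaderElection μ m β H Z →
      ∀ i : ℕ, ∃ G : Set Ω, MeasurableSet G ∧
        ENNReal.ofReal (1 - Real.exp (-(c * κ ^ (1 - ε)))) ≤ μ G ∧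
        ∀ ω ∈ G, ∀ (Node Block Tx : Type*) (E : ExpectedConsensus.Execution Node Block Tx),
          E.Admissible (fun r => H r ω) (fun r => Z r ω) →
          ∀ L : List (Finset Block) → List Tx,
            E.IsLedgerRule (fun r => H r ω) (fun r => Z r ω) L →
            E.Persistence L κ i ∧ E.Liveness L κ i := by
  obtain ⟨W, hW, A, r, hA, hr0, hr1, hmain⟩ :=
    ExpectedConsensus.exists_measure_no_isCut_le hm hβ0 hβ1 hsec
  obtain ⟨c, hc, κ₀, hκ₀, hbound⟩ := ExpectedConsensus.exists_two_mul_pow_le hA hr0 hr1 hW hε0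
  refine ⟨c, hc, κ₀, fun κ hκ Ω _ μ _ H Z hE i => ?_⟩
  set n := ⌊κ⌋₊ with hn
  have hnκ : (n : ℝ) ≤ κ := Nat.floor_le (hκ₀.trans hκ)
  have hkW : n / W * W ≤ n := Nat.div_mul_le_self n W
  -- The windows start at `i - n + 1` and `i + 1` and have length at most `n`. The events involve
  -- elections only, so one good set serves all executions.
  set bad : ℕ → Set Ω := fun a => {ω | ∀ j ∈ Finset.Ico a (a + n / W * W),
    ¬ ExpectedConsensus.IsCut (fun t => H t ω) (fun t => Z t ω) j} with hbad
  set B := MeasureTheory.toMeasurable μ (bad (i - n + 1) ∪ bad (i + 1)) with hB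
  have hBm : MeasurableSet B := MeasureTheory.measurableSet_toMeasurable _ _
  have hμB : μ B ≤ ENNReal.ofReal (Real.exp (-(c * κ ^ (1 - ε)))) := by
    rw [hB, MeasureTheory.measure_toMeasurable]
    calc _ ≤ μ (bad (i - n + 1)) + μ (bad (i + 1)) := MeasureTheory.measure_union_le _ _
      _ ≤ ENNReal.ofReal (A * r ^ (n / W)) + ENNReal.ofReal (A * r ^ (n / W)) :=
        add_le_add (hmain Ω μ H Z hE _ _ (by omega)) (hmain Ω μ H Z hE _ _ (by omega))
      _ = ENNReal.ofReal (2 * (A * r ^ (n / W))) := by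
        rw [← ENNReal.ofReal_add (by positivity) (by positivity), two_mul]
      _ ≤ _ := ENNReal.ofReal_le_ofReal (hbound κ hκ)
  refine ⟨Bᶜ, hBm.compl, ?_, ?_⟩
  · rw [MeasureTheory.prob_compl_eq_one_sub hBm, ENNReal.ofReal_sub _ (Real.exp_pos _).le,
      ENNReal.ofReal_one]
    gcongr
  · intro ω hω Node Block Tx E hadm L hL
    have hω' : ω ∉ bad (i - n + 1) ∪ bad (i + 1) := fun h =>
      hω (MeasureTheory.subset_toMeasurable _ _ h)
    simp only [hbad, Set.mem_union, Set.mem_ofPred_eq, not_or, not_forall, not_not,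
      Finset.mem_Ico] at hω'
    obtain ⟨⟨j, hj, hcut⟩, ⟨j', hj', hcut'⟩⟩ := hω'
    constructor
    · rcases lt_or_ge i n with h | h
      · refine ExpectedConsensus.Execution.persistence_of_lt (lt_of_lt_of_le ?_ hnκ)
        exact_mod_cast h
      · refine hadm.persistence hL hcut (by omega) ?_
        have h1 : (i : ℝ) < j + n := by exact_mod_cast (by omega : i < j + n)
        linarith
    · refine hadm.liveness hL hcut' (by omega) ?_
      have h1 : (j' : ℝ) ≤ i + n := by exact_mod_cast (by omega : j' ≤ i + n)
      linarith
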